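/- Let $\mathbf M=(a_{ij})$ and $\mathbf N=(b_{ij})$ be real symmetric $3\times 3$ matrices, and let $\mathcal M:\ (x,y,1)\,\mathbf M\,(x,y,1)^t=0$ and $\mathcal N:\ (x,y,1)\,\mathbf N\,(x,y,1)^t=0$. Let $\mathbf M_2,\mathbf N_2$ be the leading $2\times2$ blocks, $T_1=\det\mathbf M_2$, $L_0=\det\mathbf N$, $L_3=\det\mathbf M$. Suppose that $\mathcal M$ is a real ellipse ($T_1>0$, $(a_{11}+a_{22})L_3<0$) and $\mathcal N$ is a nondegenerate parabola ($\det\mathbf N_2=0$, $L_0\ne0$), with signs normalised so that $L_0<0$ and $L_3<0$; then the interior of each curve is the set where its quadratic polynomial is negative. Put $$L_1=L_0\,\mathrm{tr}(\mathbf N^{-1}\mathbf M),\quad L_2=L_3\,\mathrm{tr}(\mathbf M^{-1}\mathbf N),\quad T=T_1\,\mathrm{tr}(\mathbf M_2^{-1}\mathbf N_2),$$ so that $\det(\lambda\mathbf N+\mathbf M)=L_0\lambda^3+L_1\lambda^2+L_2\lambda+L_3$, and $$\Delta=-27L_0^2L_3^2+18L_0L_1L_2L_3+L_1^2L_2^2-4L_1^3L_3-4L_0L_2^3,\qquad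 \Delta'=4L_1^2-12L_0L_2,$$ $$I_2=-T_1^3L_0+L_3T^3,\qquad I_3=-L_0T_1^3+L_1TT_1^2-L_2T^2T_1+L_3T^3,$$ $$I_4=3L_0T_1^2-2L_1TT_1+L_2T^2,\qquad I_5=-3L_0T_1+L_1T.$$ A common real point of $\mathcal M$ and $\mathcal N$ is a tangent point if both curves have the same tangent line there, inner or outer according to whether the two curves lie on the same side or on opposite sides of that line; otherwise it is called an intersection point. Then: 1. $\mathcal M$ and $\mathcal N$ are separated (the curves together with their interiors are disjoint) iff $\Delta>0$ and ($L_1>0$ or $L_2>0$). 2. $\mathcal M$ and $\mathcal N$ are externally tangent (exactly one common point, an outer tangent point) iff $\Delta=0$ and ($L_1>0$ or $L_2>0$). 3. $\mathcal M$ is inside $\mathcal N$ (together with its interior it lies in the interior of $\mathcal N$) iff $\{\Delta>0,\ L_1<0,\ L_2<0,\ I_4>0\}$ or $\{\Delta>0,\ L_1<0,\ L_2<0,\ I_5\ge0,\ I_4\le0,\ I_3\le0\}$ or $\{I_3=0,\ I_4=0,\ I_5>0\}$. 4. The common points are exactly two intersection points iff $\Delta<0$. 5. The common points are exactly four intersection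 points iff $\Delta>0$, $I_4<0$ and $I_5<0$. 6. The common points are exactly one inner tangent point and two intersection points iff $I_2\le0$, $\Delta=0$, $\Delta'\neq0$, $I_4<0$, $I_5<0$. 7. The only common point is one inner tangent point iff $\{\Delta=0,\ L_1<0,\ L_2<0,\ I_3<0$ and ($I_4>0$ or $I_5>0$)$\}$ or $\{\Delta=0,\ L_1<0,\ L_2<0,\ I_3=0,\ I_5>0,\ I_4<0\}$ or $\{I_3=0,\ I_5=0,\ I_4=0\}$. 8. The common points are exactly two inner tangent points iff $I_3=0$, $I_4=0$ and $I_5<0$. 9. The common points are exactly one intersection point and one inner tangent point iff $\Delta=0$, $\Delta'=0$, $I_3<0$ and $I_5<0$. -/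

import Mathlib

namespace ConicPosition

open scoped Matrix

/-! ### Conics in the affine plane -/

/-- The row `(x, y, 1)` attached to a point of the plane. -/
def hom (p : ℝ × ℝ) : Fin 3 → ℝ := ![p.1, p.2, 1]

/-- The value `(x, y, 1) A (x, y, 1)ᵗ`. -/
def conicValue (A : Matrix (Fin 3) (Fin 3) ℝ) (p : ℝ × ℝ) : ℝ :=
  hom p ⬝ᵥ (A *ᵥ hom p)

/-- The conic `(x, y, 1) A (x, y, 1)ᵗ = 0`, as a set of real points. -/
def curve (A : Matrix (Fin 3) (Fin 3) ℝ) : Set (ℝ × ℝ) := {p | conicValue A p = 0}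

/-- The open region `(x, y, 1) A (x, y, 1)ᵗ < 0`; for an ellipse and for a parabola of negative
determinant this is the (convex) interior. -/
def inside (A : Matrix (Fin 3) (Fin 3) ℝ) : Set (ℝ × ℝ) := {p | conicValue A p < 0}

/-- The leading `2 × 2` block, the matrix of the quadratic part. -/
def quadPart (A : Matrix (Fin 3) (Fin 3) ℝ) : Matrix (Fin 2) (Fin 2) ℝ :=
  !![A 0 0, A 0 1; A 1 0, A 1 1]

/-- The symmetric matrix `A` defines a real ellipse. -/
def IsEllipse (A : Matrix (Fin 3) (Fin 3) ℝ) : Prop :=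
  A.IsSymm ∧ 0 < (quadPart A).det ∧ (A 0 0 + A 1 1) * A.det < 0

/-- The symmetric matrix `A` defines a (nondegenerate) parabola. -/
def IsParabola (A : Matrix (Fin 3) (Fin 3) ℝ) : Prop :=
  A.IsSymm ∧ (quadPart A).det = 0 ∧ A.det ≠ 0

/-! ### Relative positions -/

/-- The tangent line to the conic `A` at the point `p` of it, as the polar line of `p`. -/
def tangentLine (A : Matrix (Fin 3) (Fin 3) ℝ) (p : ℝ × ℝ) : Set (ℝ × ℝ) :=
  {v | hom v ⬝ᵥ (A *ᵥ hom p) = 0}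

/-- The line with equation `ℓ₀ x + ℓ₁ y + ℓ₂ = 0`. -/
def lineOf (l : Fin 3 → ℝ) : Set (ℝ × ℝ) := {v | hom v ⬝ᵥ l = 0}

/-- The real points common to both conics. -/
def commonPoints (M N : Matrix (Fin 3) (Fin 3) ℝ) : Set (ℝ × ℝ) := curve M ∩ curve N

/-- Common points at which the two conics have different tangent lines. -/
def crossingPoints (M N : Matrix (Fin 3) (Fin 3) ℝ) : Set (ℝ × ℝ) :=
  {p | p ∈ commonPoints M N ∧ tangentLine M p ≠ tangentLine N p}

/-- Common points at which the conics have the same tangent line, with both curves on the same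
side of that line. -/
def innerTangentPoints (M N : Matrix (Fin 3) (Fin 3) ℝ) : Set (ℝ × ℝ) :=
  {p | p ∈ commonPoints M N ∧ tangentLine M p = tangentLine N p ∧
    ∃ l : Fin 3 → ℝ, lineOf l = tangentLine M p ∧
      (∀ v ∈ curve M, 0 ≤ hom v ⬝ᵥ l) ∧ (∀ v ∈ curve N, 0 ≤ hom v ⬝ᵥ l)}

/-- Common points at which the conics have the same tangent line, with the curves on opposite
sides of that line. -/
def outerTangentPoints (M N : Matrix (Fin 3) (Fin 3) ℝ) : Set (ℝ × ℝ) :=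
  {p | p ∈ commonPoints M N ∧ tangentLine M p = tangentLine N p ∧
    ∃ l : Fin 3 → ℝ, lineOf l = tangentLine M p ∧
      (∀ v ∈ curve M, 0 ≤ hom v ⬝ᵥ l) ∧ (∀ v ∈ curve N, hom v ⬝ᵥ l ≤ 0)}

/-- The common points of the conics are exactly: `c` points of intersection (crossings), `i` inner
tangent points and `o` outer tangent points. -/
def HasExactly (M N : Matrix (Fin 3) (Fin 3) ℝ) (c i o : ℕ) : Prop :=
  (crossingPoints M N).encard = c ∧ (innerTangentPoints M N).encard = i ∧
    (outerTangentPoints M N).encard = o ∧ (commonPoints M N).encard = (c + i + o : ℕ)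

/-- The conics together with their interiors have no point in common. -/
def Separated (M N : Matrix (Fin 3) (Fin 3) ℝ) : Prop :=
  Disjoint (inside M ∪ curve M) (inside N ∪ curve N)

/-- The conic `M`, together with its interior, lies in the interior of `N`. -/
def IsInside (M N : Matrix (Fin 3) (Fin 3) ℝ) : Prop :=
  inside M ∪ curve M ⊆ inside N

/-- One common point, an outer tangent point. -/
def ExternallyTangent (M N : Matrix (Fin 3) (Fin 3) ℝ) : Prop := HasExactly M N 0 0 1

/-! ### Invariants of the pencil -/

section Invariants

variable (M N : Matrix (Fin 3) (Fin 3) ℝ)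

noncomputable def L0 : ℝ := N.det

noncomputable def L3 : ℝ := M.det

noncomputable def L1 : ℝ := L0 N * (N⁻¹ * M).trace

noncomputable def L2 : ℝ := L3 M * (M⁻¹ * N).trace

noncomputable def T1 : ℝ := (quadPart M).det

noncomputable def T : ℝ := T1 M * ((quadPart M)⁻¹ * quadPart N).trace

/-- The discriminant of `det (X N + M) = L0 X³ + L1 X² + L2 X + L3`. -/
noncomputable def disc : ℝ :=
  -27 * L0 N ^ 2 * L3 M ^ 2 + 18 * L0 N * L1 M N * L2 M N * L3 M + L1 M N ^ 2 * L2 M N ^ 2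
    - 4 * L1 M N ^ 3 * L3 M - 4 * L0 N * L2 M N ^ 3

/-- The discriminant of the derivative `3 L0 X² + 2 L1 X + L2`. -/
noncomputable def disc' : ℝ := 4 * L1 M N ^ 2 - 12 * L0 N * L2 M N

noncomputable def I2 : ℝ := -T1 M ^ 3 * L0 N + L3 M * T M N ^ 3

noncomputable def I3 : ℝ :=
  -L0 N * T1 M ^ 3 + L1 M N * T M N * T1 M ^ 2 - L2 M N * T M N ^ 2 * T1 M + L3 M * T M N ^ 3

noncomputable def I4 : ℝ :=
  3 * L0 N * T1 M ^ 2 - 2 * L1 M N * T M N * T1 M + L2 M N * T M N ^ 2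

noncomputable def I5 : ℝ := -3 * L0 N * T1 M + L1 M N * T M N

end Invariants

end ConicPosition

/-!
Affine maps and positive rescalings of the two equations change neither the relative position of the
conics nor the signs of the invariants (`position_transfer`, `signCondition_transfer`). Taking the
centre of the ellipse as origin and, as axes, conjugate directions of the ellipse of which one is
the direction of the axis of the parabola, one may assume (`exists_normal_form`) that `M` is the
unit circle and `N` is `x² + 2 g x + 2 f y + c = 0` with `f ≠ 0`. In this normal form `F(X) = det (X
N + M)` becomes, in the variable `X + 1 = r`, the cubic `-f² r³ + I5 r² + I4 r + I3`, and `I3 =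
-g²`.

Positions with at most one common point are read off from the pencil. For `X > -1` the polynomial of
`X N + M` is a positive combination of two squares plus `F(X) / (X + 1)` (`pencil_identity`). If
`F(X) > 0` it is positive everywhere, which separates the conics when `X > 0` and puts `M` inside
`N` when `-1 < X < 0`. At a double root `X ≠ 0` of `F` it vanishes at one point, which is the only
common point of the conics; the tangency there is outer or inner according to the sign of `X`. The
one position that escapes this, where `F` has the triple root `-1` and the quartic below is `t⁴`, is
treated by hand (`hasExactly_inner_of_osculating`).

For the other positions, the numbers `x + g`, for `(x, y)` a common point, are the roots of a
quartic whose multiple roots are the tangent points (`hasExactly_of_quartic`). Its resolvent cubic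
is again `F`, so when the roots `r` are real, two of them negative and the third nonpositive, the
quartic splits over `ℝ` and its roots are explicit in the square roots of the numbers `-f² r`
(`exists_hasRoots`). If only one `r` is negative and the others vanish, the quartic is a square
(`hasExactly_two_inner_of_centered`). When `F` has only one real root, the quartic is a product of
two real quadratics with discriminants of opposite signs (`hasExactly_two_of_disc_neg`).

In this way each sign condition implies the corresponding position (`position_of_signCondition`).
The converse implications are formal: the sign conditions cover all cases (`exists_signCondition`),
and the positions exclude each other (`position_exclusive`).
-/

/-! ### Real cubics -/

namespace ConicPosition

lemma exists_root_cubic {a : ℝ} (ha : a ≠ 0) (b c d : ℝ) :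
    ∃ r : ℝ, a * r ^ 3 + b * r ^ 2 + c * r + d = 0 := by
  set B := 1 + (|b| + |c| + |d|) / |a| with hB
  have ha' : 0 < |a| := abs_pos.mpr ha
  have hB1 : 1 ≤ B := by
    have : 0 ≤ (|b| + |c| + |d|) / |a| := by positivity
    linarith
  have haB : |a| * B = |a| + (|b| + |c| + |d|) := by
    rw [hB]; field_simp
  have h0 : 0 ≤ B := by linarith
  -- at `± B` the cubic term dominates the sum of the others
  have hdom : ∀ x : ℝ, |x| = B → |b * x ^ 2 + c * x + d| < |a| * B ^ 3 := by
    intro x hx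
    have h1 : |b * x ^ 2 + c * x + d| ≤ |b| * B ^ 2 + |c| * B + |d| := by
      calc |b * x ^ 2 + c * x + d| ≤ |b * x ^ 2| + |c * x| + |d| := abs_add_three _ _ _
        _ = _ := by rw [abs_mul, abs_mul, abs_pow, hx]
    have h2 : |c| * B ≤ |c| * B ^ 2 := by
      apply mul_le_mul_of_nonneg_left _ (abs_nonneg c); nlinarith
    have h3 : |d| ≤ |d| * B ^ 2 := by
      have : 1 ≤ B ^ 2 := by nlinarith
      nlinarith [abs_nonneg d]
    have h4 : |a| * B ^ 3 = (|a| + (|b| + |c| + |d|)) * B ^ 2 := by rw [← haB]; ring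
    have h5 : 0 < |a| * B ^ 2 := by positivity
    nlinarith
  have h1 := abs_lt.mp (hdom B (abs_of_nonneg h0))
  have h2 := abs_lt.mp (hdom (-B) (by rw [abs_neg, abs_of_nonneg h0]))
  have hcont : ContinuousOn (fun r : ℝ => a * r ^ 3 + b * r ^ 2 + c * r + d) (Set.uIcc (-B) B) := by
    fun_prop
  have hmem : (0 : ℝ) ∈ Set.uIcc ((fun r : ℝ => a * r ^ 3 + b * r ^ 2 + c * r + d) (-B))
      ((fun r : ℝ => a * r ^ 3 + b * r ^ 2 + c * r + d) B) := by
    rw [Set.mem_uIcc]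
    rcases abs_cases a with ⟨h, -⟩ | ⟨h, -⟩ <;> rw [h] at h1 h2
    · left; constructor <;> nlinarith
    · right; constructor <;> nlinarith
  obtain ⟨r, -, hr⟩ := intermediate_value_uIcc hcont hmem
  exact ⟨r, hr⟩

lemma exists_roots_quadratic {p b c : ℝ} (hp : p ≠ 0) (h : 0 ≤ b ^ 2 + 4 * p * c) :
    ∃ r s : ℝ, b = p * (r + s) ∧ c = -p * (r * s) := by
  obtain ⟨w, hs⟩ : ∃ w, w ^ 2 = b ^ 2 + 4 * p * c := ⟨_, Real.sq_sqrt h⟩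
  refine ⟨(b + w) / (2 * p), (b - w) / (2 * p), ?_, ?_⟩
  · field_simp; ring
  · field_simp; linear_combination -hs

/-- A real cubic of nonnegative discriminant splits over `ℝ`. -/
lemma exists_roots_cubic {p : ℝ} (hp : p ≠ 0) (b c d : ℝ)
    (h : 0 ≤ -27 * p ^ 2 * d ^ 2 - 18 * p * b * c * d + b ^ 2 * c ^ 2 - 4 * b ^ 3 * d
      + 4 * p * c ^ 3) :
    ∃ r s t : ℝ, r ≤ s ∧ s ≤ t ∧ b = p * (r + s + t) ∧ c = -p * (r * s + r * t + s * t) ∧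
      d = p * (r * s * t) := by
  suffices H : ∃ r s t : ℝ, b = p * (r + s + t) ∧ c = -p * (r * s + r * t + s * t) ∧
      d = p * (r * s * t) by
    obtain ⟨r, s, t, hb, hc, hd⟩ := H
    rcases le_total r s with h1 | h1 <;> rcases le_total s t with h2 | h2 <;>
      rcases le_total r t with h3 | h3
    · exact ⟨r, s, t, h1, h2, hb, hc, hd⟩
    · exact ⟨r, s, t, h1, h2, hb, hc, hd⟩
    · exact ⟨r, t, s, h3, h2, by linarith, by linarith, by linarith⟩
    · exact ⟨t, r, s, h3, h1, by linarith, by linarith, by linarith⟩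
    · exact ⟨s, r, t, h1, h3, by linarith, by linarith, by linarith⟩
    · exact ⟨s, t, r, h2, h3, by linarith, by linarith, by linarith⟩
    · exact ⟨t, s, r, h2, h1, by linarith, by linarith, by linarith⟩
    · exact ⟨t, s, r, h2, h1, by linarith, by linarith, by linarith⟩
  obtain ⟨r, hr⟩ := exists_root_cubic (neg_ne_zero.mpr hp) b c d
  -- the quotient by `X - r` is `-p X² + β X + γ`
  obtain ⟨β, hβ⟩ : ∃ β, β = b - p * r := ⟨_, rfl⟩
  obtain ⟨γ, hγ⟩ : ∃ γ, γ = c + r * β := ⟨_, rfl⟩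
  obtain rfl : b = β + p * r := by linarith
  obtain rfl : c = γ - r * β := by linarith
  obtain rfl : d = -r * γ := by linarith
  have key : 0 ≤ (β ^ 2 + 4 * p * γ) * (-p * r ^ 2 + β * r + γ) ^ 2 := by
    refine h.trans (le_of_eq ?_); ring
  have hquad : 0 ≤ β ^ 2 + 4 * p * γ := by
    by_contra hneg
    push Not at hneg
    have h0 : (-p * r ^ 2 + β * r + γ) = 0 := by
      by_contra hne
      have := mul_neg_of_neg_of_pos hneg (sq_pos_of_ne_zero hne)
      linarith
    have : β ^ 2 + 4 * p * γ = (β - 2 * p * r) ^ 2 := by linear_combination 4 * p * h0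
    nlinarith [sq_nonneg (β - 2 * p * r)]
  obtain ⟨s, t, h1, h2⟩ := exists_roots_quadratic hp hquad
  refine ⟨r, s, t, ?_, ?_, ?_⟩
  · rw [h1]; ring
  · rw [h1, h2]; ring
  · rw [h2]; ring

end ConicPosition

/-! ### A circle and a parabola with vertical axis -/

namespace ConicPosition

open scoped Matrix

/-- The matrix of the unit circle. -/
def circ : Matrix (Fin 3) (Fin 3) ℝ := !![1, 0, 0; 0, 1, 0; 0, 0, -1]

/-- The matrix of the parabola `x² + 2 g x + 2 f y + c = 0`. -/
def para (g f c : ℝ) : Matrix (Fin 3) (Fin 3) ℝ := !![1, 0, g; 0, 0, f; g, f, c]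

variable {g f c : ℝ}

lemma hom_dotProduct (v : ℝ × ℝ) (l : Fin 3 → ℝ) : hom v ⬝ᵥ l = v.1 * l 0 + v.2 * l 1 + l 2 := by
  simp [hom, dotProduct, Fin.sum_univ_three]

lemma polar_circ (v p : ℝ × ℝ) : hom v ⬝ᵥ (circ *ᵥ hom p) = v.1 * p.1 + v.2 * p.2 - 1 := by
  simp [circ, Matrix.mulVec, dotProduct, Fin.sum_univ_three, hom]
  ring

lemma polar_para (v p : ℝ × ℝ) : hom v ⬝ᵥ (para g f c *ᵥ hom p) =
    v.1 * (p.1 + g) + v.2 * f + (g * p.1 + f * p.2 + c) := by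
  simp [para, Matrix.mulVec, dotProduct, Fin.sum_univ_three, hom]

lemma conicValue_circ (p : ℝ × ℝ) : conicValue circ p = p.1 ^ 2 + p.2 ^ 2 - 1 := by
  rw [conicValue, polar_circ]; ring

lemma conicValue_para (p : ℝ × ℝ) :
    conicValue (para g f c) p = p.1 ^ 2 + 2 * g * p.1 + 2 * f * p.2 + c := by
  rw [conicValue, polar_para]; ring

lemma mem_commonPoints {p : ℝ × ℝ} : p ∈ commonPoints circ (para g f c) ↔
    p.1 ^ 2 + p.2 ^ 2 = 1 ∧ p.1 ^ 2 + 2 * g * p.1 + 2 * f * p.2 + c = 0 := by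
  simp only [commonPoints, curve, Set.mem_inter_iff, Set.mem_ofPred_eq, conicValue_circ,
    conicValue_para, sub_eq_zero]

lemma tangentLine_eq_iff (hf : f ≠ 0) {p : ℝ × ℝ} (hp : p ∈ commonPoints circ (para g f c)) :
    tangentLine circ p = tangentLine (para g f c) p ↔ p.1 * f = p.2 * (p.1 + g) := by
  obtain ⟨h1, h2⟩ := mem_commonPoints.mp hp
  obtain ⟨x, y⟩ := p
  simp only at h1 h2 ⊢
  constructor
  · intro h
    have hmem : (x - y, y + x) ∈ tangentLine circ (x, y) := by
      simp only [tangentLine, Set.mem_ofPred_eq, polar_circ]; linear_combination h1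
    rw [h] at hmem
    simp only [tangentLine, Set.mem_ofPred_eq, polar_para] at hmem
    linear_combination hmem - h2
  · intro h
    have hy : y ≠ 0 := by
      rintro rfl
      have : x = 0 := by
        rcases mul_eq_zero.mp (h.trans (zero_mul _)) with h | h
        · exact h
        · exact absurd h hf
      subst this
      norm_num at h1
    ext v
    simp only [tangentLine, Set.mem_ofPred_eq, polar_circ, polar_para]
    -- the second equation is `f / y` times the first one
    have key : y * (v.1 * (x + g) + v.2 * f + (g * x + f * y + c)) =
        f * (v.1 * x + v.2 * y - 1) := by
      linear_combination (-v.1) * h + y * h2 - f * h1 + x * h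
    constructor
    · intro hv
      rw [hv, mul_zero] at key
      exact (mul_eq_zero.mp key).resolve_left hy
    · intro hv
      rw [hv, mul_zero] at key
      exact (mul_eq_zero.mp key.symm).resolve_left hf

/-- The points of the parabola seen from the common tangent at `p`. -/
lemma para_tangent_identity {p : ℝ × ℝ} (hp : p ∈ commonPoints circ (para g f c))
    (ht : p.1 * f = p.2 * (p.1 + g)) {v : ℝ × ℝ} (hv : v ∈ curve (para g f c)) :
    2 * f * (1 - (v.1 * p.1 + v.2 * p.2)) = p.2 * (v.1 - p.1) ^ 2 := by
  obtain ⟨h1, h2⟩ := mem_commonPoints.mp hp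
  simp only [curve, Set.mem_ofPred_eq, conicValue_para] at hv
  linear_combination (-2) * f * h1 + p.2 * h2 - p.2 * hv + (-2) * (v.1 - p.1) * ht

lemma circ_le_one {p v : ℝ × ℝ} (hp : p.1 ^ 2 + p.2 ^ 2 = 1) (hv : v ∈ curve circ) :
    v.1 * p.1 + v.2 * p.2 ≤ 1 := by
  simp only [curve, Set.mem_ofPred_eq, conicValue_circ] at hv
  nlinarith [sq_nonneg (v.1 - p.1), sq_nonneg (v.2 - p.2)]

/-- An affine function vanishing exactly on the tangent of the circle at `p` and nonnegative on
the circle is a negative multiple of `⟨v, p⟩ - 1`. -/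
lemma eq_neg_mul_of_lineOf_eq {p : ℝ × ℝ} (hp : p.1 ^ 2 + p.2 ^ 2 = 1) {l : Fin 3 → ℝ}
    (hl : lineOf l = tangentLine circ p) (hc : ∀ v ∈ curve circ, 0 ≤ hom v ⬝ᵥ l) :
    ∃ τ < 0, ∀ v : ℝ × ℝ, hom v ⬝ᵥ l = τ * (v.1 * p.1 + v.2 * p.2 - 1) := by
  obtain ⟨x, y⟩ := p
  simp only at hp ⊢
  have hmem : ∀ v : ℝ × ℝ, v.1 * l 0 + v.2 * l 1 + l 2 = 0 ↔ v.1 * x + v.2 * y - 1 = 0 := by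
    intro v
    have := Set.ext_iff.mp hl v
    simp only [lineOf, tangentLine, Set.mem_ofPred_eq, polar_circ] at this
    rwa [hom_dotProduct] at this
  have e1 : x * l 0 + y * l 1 + l 2 = 0 := (hmem (x, y)).mpr (by linear_combination hp)
  have e2 : (x - y) * l 0 + (y + x) * l 1 + l 2 = 0 :=
    (hmem (x - y, y + x)).mpr (by linear_combination hp)
  have e0 : l 2 ≠ 0 := by
    intro h
    have := (hmem (0, 0)).mp (by simp [h])
    norm_num at this
  have hneg : (-x, -y) ∈ curve circ := by
    simp only [curve, Set.mem_ofPred_eq, conicValue_circ]; linear_combination hp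
  have h3 := hc _ hneg
  rw [hom_dotProduct] at h3
  simp only at h3
  have h4 : 0 < l 2 := lt_of_le_of_ne (by linarith) e0.symm
  refine ⟨-l 2, by linarith, fun v => ?_⟩
  rw [hom_dotProduct]
  linear_combination v.1 * (x * e1 + (-y) * (e2 - e1) - l 0 * hp) +
    v.2 * (y * e1 + x * (e2 - e1) - l 1 * hp)

lemma mem_crossingPoints (hf : f ≠ 0) {p : ℝ × ℝ} : p ∈ crossingPoints circ (para g f c) ↔
    p ∈ commonPoints circ (para g f c) ∧ p.1 * f ≠ p.2 * (p.1 + g) := by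
  simp only [crossingPoints, Set.mem_ofPred_eq]
  refine and_congr_right fun hp => not_congr (tangentLine_eq_iff hf hp)

lemma lineOf_tangent (p : ℝ × ℝ) : lineOf ![-p.1, -p.2, 1] = tangentLine circ p := by
  ext v
  simp only [lineOf, tangentLine, Set.mem_ofPred_eq, polar_circ]
  simp only [hom_dotProduct, Matrix.cons_val]
  constructor <;> intro h <;> linarith

lemma snd_ne_zero_of_tangent (hf : f ≠ 0) {p : ℝ × ℝ} (hp : p.1 ^ 2 + p.2 ^ 2 = 1)
    (ht : p.1 * f = p.2 * (p.1 + g)) : p.2 ≠ 0 := by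
  intro h
  rw [h, zero_mul] at ht
  rcases mul_eq_zero.mp ht with h' | h'
  · rw [h, h'] at hp; norm_num at hp
  · exact hf h'

lemma exists_mem_para (hf : f ≠ 0) (x : ℝ) : ∃ y, (x, y) ∈ curve (para g f c) := by
  refine ⟨-(x ^ 2 + 2 * g * x + c) / (2 * f), ?_⟩
  simp only [curve, Set.mem_ofPred_eq, conicValue_para]
  field_simp
  ring

lemma mem_innerTangentPoints (hf : f ≠ 0) {p : ℝ × ℝ} :
    p ∈ innerTangentPoints circ (para g f c) ↔
    p ∈ commonPoints circ (para g f c) ∧ p.1 * f = p.2 * (p.1 + g) ∧ 0 < p.2 * f := by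
  simp only [innerTangentPoints, Set.mem_ofPred_eq]
  refine and_congr_right fun hp => ?_
  rw [tangentLine_eq_iff hf hp]
  refine and_congr_right fun ht => ?_
  have h1 := (mem_commonPoints.mp hp).1
  have hy := snd_ne_zero_of_tangent hf h1 ht
  constructor
  · rintro ⟨l, hl, hc, hn⟩
    obtain ⟨τ, hτ, hτl⟩ := eq_neg_mul_of_lineOf_eq h1 hl hc
    obtain ⟨y, hv⟩ := exists_mem_para (g := g) (c := c) hf (p.1 + 1)
    have e1 := para_tangent_identity hp ht hv
    have e2 := hn _ hv
    rw [hτl] at e2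
    simp only at e1 e2
    have e3 : 0 ≤ 1 - ((p.1 + 1) * p.1 + y * p.2) := by nlinarith
    have e4 : 2 * f ^ 2 * (1 - ((p.1 + 1) * p.1 + y * p.2)) = p.2 * f := by
      linear_combination f * e1
    refine lt_of_le_of_ne ?_ (mul_ne_zero hy hf).symm
    rw [← e4]; positivity
  · intro hpos
    refine ⟨![-p.1, -p.2, 1], lineOf_tangent p, fun v hv => ?_, fun v hv => ?_⟩
    · have := circ_le_one h1 hv
      simp only [hom_dotProduct, Matrix.cons_val]; linarith
    · have e1 := para_tangent_identity hp ht hv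
      have e4 : 2 * f ^ 2 * (1 - (v.1 * p.1 + v.2 * p.2)) = p.2 * f * (v.1 - p.1) ^ 2 := by
        linear_combination f * e1
      have e5 : 0 ≤ 2 * f ^ 2 * (1 - (v.1 * p.1 + v.2 * p.2)) := by rw [e4]; positivity
      have e6 := nonneg_of_mul_nonneg_right e5 (by positivity)
      simp only [hom_dotProduct, Matrix.cons_val]; linarith

lemma mem_outerTangentPoints (hf : f ≠ 0) {p : ℝ × ℝ} :
    p ∈ outerTangentPoints circ (para g f c) ↔
    p ∈ commonPoints circ (para g f c) ∧ p.1 * f = p.2 * (p.1 + g) ∧ p.2 * f < 0 := by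
  simp only [outerTangentPoints, Set.mem_ofPred_eq]
  refine and_congr_right fun hp => ?_
  rw [tangentLine_eq_iff hf hp]
  refine and_congr_right fun ht => ?_
  have h1 := (mem_commonPoints.mp hp).1
  have hy := snd_ne_zero_of_tangent hf h1 ht
  constructor
  · rintro ⟨l, hl, hc, hn⟩
    obtain ⟨τ, hτ, hτl⟩ := eq_neg_mul_of_lineOf_eq h1 hl hc
    obtain ⟨y, hv⟩ := exists_mem_para (g := g) (c := c) hf (p.1 + 1)
    have e1 := para_tangent_identity hp ht hv
    have e2 := hn _ hv
    rw [hτl] at e2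
    simp only at e1 e2
    have e3 : 1 - ((p.1 + 1) * p.1 + y * p.2) ≤ 0 := by nlinarith
    have e4 : 2 * f ^ 2 * (1 - ((p.1 + 1) * p.1 + y * p.2)) = p.2 * f := by
      linear_combination f * e1
    refine lt_of_le_of_ne ?_ (mul_ne_zero hy hf)
    rw [← e4]; exact mul_nonpos_of_nonneg_of_nonpos (by positivity) e3
  · intro hneg
    refine ⟨![-p.1, -p.2, 1], lineOf_tangent p, fun v hv => ?_, fun v hv => ?_⟩
    · have := circ_le_one h1 hv
      simp only [hom_dotProduct, Matrix.cons_val]; linarith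
    · have e1 := para_tangent_identity hp ht hv
      have e4 : 2 * f ^ 2 * (1 - (v.1 * p.1 + v.2 * p.2)) = p.2 * f * (v.1 - p.1) ^ 2 := by
        linear_combination f * e1
      have e5 : 2 * f ^ 2 * (1 - (v.1 * p.1 + v.2 * p.2)) ≤ 0 := by
        rw [e4]; exact mul_nonpos_of_nonpos_of_nonneg hneg.le (sq_nonneg _)
      have e6 := nonpos_of_mul_nonpos_right e5 (by positivity)
      simp only [hom_dotProduct, Matrix.cons_val]; linarith

/-- An outer tangent point is the only common point: the tangent line separates the curves. -/
lemma eq_of_mem_outerTangentPoints (hf : f ≠ 0) {p v : ℝ × ℝ}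
    (hp : p ∈ outerTangentPoints circ (para g f c)) (hv : v ∈ commonPoints circ (para g f c)) :
    v = p := by
  obtain ⟨hp, ht, hneg⟩ := (mem_outerTangentPoints hf).mp hp
  have h1 := (mem_commonPoints.mp hp).1
  have h2 := (mem_commonPoints.mp hv).1
  have e1 := para_tangent_identity hp ht hv.2
  have e2 := circ_le_one h1 hv.1
  have e4 : 2 * f ^ 2 * (1 - (v.1 * p.1 + v.2 * p.2)) = p.2 * f * (v.1 - p.1) ^ 2 := by
    linear_combination f * e1
  have e5 : 2 * f ^ 2 * (1 - (v.1 * p.1 + v.2 * p.2)) ≤ 0 := by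
    rw [e4]; exact mul_nonpos_of_nonpos_of_nonneg hneg.le (sq_nonneg _)
  have e6 := nonpos_of_mul_nonpos_right e5 (by positivity)
  have e7 : (v.1 - p.1) ^ 2 + (v.2 - p.2) ^ 2 ≤ 0 := by nlinarith
  have e8 : (v.1 - p.1) = 0 := by nlinarith [sq_nonneg (v.1 - p.1), sq_nonneg (v.2 - p.2)]
  have e9 : (v.2 - p.2) = 0 := by nlinarith [sq_nonneg (v.1 - p.1), sq_nonneg (v.2 - p.2)]
  exact Prod.ext (by linarith) (by linarith)

/-! ### The pencil spanned by the circle and the parabola -/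

/-- `det (X N + M)` for the circle `M` and the parabola `N`. -/
def pencilDet (g f c X : ℝ) : ℝ :=
  -f ^ 2 * X ^ 3 + (c - f ^ 2 - g ^ 2) * X ^ 2 + (c - 1) * X - 1

/-- Completing squares in `X N + M`. -/
lemma pencil_identity (X x y : ℝ) :
    (X + 1) * (X * (x ^ 2 + 2 * g * x + 2 * f * y + c) + (x ^ 2 + y ^ 2 - 1)) =
      ((X + 1) * x + X * g) ^ 2 + (X + 1) * (y + X * f) ^ 2 + pencilDet g f c X := by
  rw [pencilDet]; ring

lemma pencil_pos {X : ℝ} (hX : -1 < X) (h : 0 < pencilDet g f c X) (p : ℝ × ℝ) :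
    0 < X * conicValue (para g f c) p + conicValue circ p := by
  have h1 : 0 < X + 1 := by linarith
  have := pencil_identity (g := g) (f := f) (c := c) X p.1 p.2
  rw [conicValue_circ, conicValue_para]
  refine pos_of_mul_pos_right (a := X + 1) ?_ h1.le
  rw [this]; positivity

lemma mem_region {A : Matrix (Fin 3) (Fin 3) ℝ} {p : ℝ × ℝ} :
    p ∈ inside A ∪ curve A ↔ conicValue A p ≤ 0 := by
  simp only [inside, curve, Set.mem_union, Set.mem_ofPred_eq, le_iff_lt_or_eq]

lemma separated_of_pencilDet_pos {X : ℝ} (hX : 0 < X) (h : 0 < pencilDet g f c X) :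
    Separated circ (para g f c) := by
  rw [Separated, Set.disjoint_left]
  intro p h1 h2
  rw [mem_region] at h1 h2
  have := pencil_pos (by linarith) h p
  nlinarith

lemma isInside_of_pencilDet_pos {X : ℝ} (hX : -1 < X) (hX' : X < 0)
    (h : 0 < pencilDet g f c X) : IsInside circ (para g f c) := by
  intro p h1
  rw [mem_region] at h1
  have := pencil_pos hX h p
  change conicValue (para g f c) p < 0
  nlinarith

lemma hasExactly_inner_of_unique (hf : f ≠ 0) {p : ℝ × ℝ}
    (hp : commonPoints circ (para g f c) = {p}) (ht : p.1 * f = p.2 * (p.1 + g))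
    (hpos : 0 < p.2 * f) : HasExactly circ (para g f c) 0 1 0 := by
  have h1 : crossingPoints circ (para g f c) = ∅ := by
    ext v
    simp only [mem_crossingPoints hf, hp, Set.mem_singleton_iff, Set.mem_empty_iff_false, iff_false]
    rintro ⟨rfl, h⟩; exact h ht
  have h2 : innerTangentPoints circ (para g f c) = {p} := by
    ext v
    simp only [mem_innerTangentPoints hf, hp, Set.mem_singleton_iff]
    refine ⟨fun h => h.1, ?_⟩
    rintro rfl; exact ⟨rfl, ht, hpos⟩
  have h3 : outerTangentPoints circ (para g f c) = ∅ := by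
    ext v
    simp only [mem_outerTangentPoints hf, hp, Set.mem_singleton_iff, Set.mem_empty_iff_false,
      iff_false]
    rintro ⟨rfl, -, h⟩; linarith
  simp [HasExactly, h1, h2, h3, hp]

lemma hasExactly_outer_of_unique (hf : f ≠ 0) {p : ℝ × ℝ}
    (hp : commonPoints circ (para g f c) = {p}) (ht : p.1 * f = p.2 * (p.1 + g))
    (hneg : p.2 * f < 0) : HasExactly circ (para g f c) 0 0 1 := by
  have h1 : crossingPoints circ (para g f c) = ∅ := by
    ext v
    simp only [mem_crossingPoints hf, hp, Set.mem_singleton_iff, Set.mem_empty_iff_false, iff_false]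
    rintro ⟨rfl, h⟩; exact h ht
  have h2 : outerTangentPoints circ (para g f c) = {p} := by
    ext v
    simp only [mem_outerTangentPoints hf, hp, Set.mem_singleton_iff]
    refine ⟨fun h => h.1, ?_⟩
    rintro rfl; exact ⟨rfl, ht, hneg⟩
  have h3 : innerTangentPoints circ (para g f c) = ∅ := by
    ext v
    simp only [mem_innerTangentPoints hf, hp, Set.mem_singleton_iff, Set.mem_empty_iff_false,
      iff_false]
    rintro ⟨rfl, -, h⟩; linarith
  simp [HasExactly, h1, h2, h3, hp]

/-- At a double root `X > -1` of the pencil determinant, `X N + M` is positive semidefinite of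
rank two, and its kernel is the only common point of the conics. -/
lemma commonPoints_eq_of_double_root {X : ℝ} (hX : -1 < X)
    (h : pencilDet g f c X = 0)
    (h' : -3 * f ^ 2 * X ^ 2 + 2 * (c - f ^ 2 - g ^ 2) * X + (c - 1) = 0) :
    commonPoints circ (para g f c) = {(-X * g / (X + 1), -X * f)} := by
  have h1 : 0 < X + 1 := by linarith
  have h0 : X + 1 ≠ 0 := h1.ne'
  ext p
  rw [mem_commonPoints, Set.mem_singleton_iff]
  constructor
  · rintro ⟨e1, e2⟩
    have e3 := pencil_identity (g := g) (f := f) (c := c) X p.1 p.2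
    rw [e2, e1, h] at e3
    have e4 : ((X + 1) * p.1 + X * g) ^ 2 = 0 := by
      nlinarith [sq_nonneg ((X + 1) * p.1 + X * g), mul_nonneg h1.le (sq_nonneg (p.2 + X * f))]
    have e5 : (X + 1) * (p.2 + X * f) ^ 2 = 0 := by linarith
    have e6 : p.2 + X * f = 0 := by simpa [h0] using e5
    have e7 : (X + 1) * p.1 + X * g = 0 := by simpa using e4
    refine Prod.ext ?_ ?_
    · simp only; field_simp; linarith
    · simp only; linarith
  · rintro rfl
    simp only
    rw [pencilDet] at h
    have e2 : (-X * g / (X + 1)) ^ 2 + 2 * g * (-X * g / (X + 1)) + 2 * f * (-X * f) + c = 0 := by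
      field_simp
      linear_combination (X + 1) * h' - h
    have e3 := pencil_identity (g := g) (f := f) (c := c) X (-X * g / (X + 1)) (-X * f)
    rw [e2, pencilDet, h] at e3
    have e4 : (X + 1) * (-X * g / (X + 1)) + X * g = 0 := by field_simp; ring
    rw [e4] at e3
    have e5 : (X + 1) * ((-X * g / (X + 1)) ^ 2 + (-X * f) ^ 2 - 1) = 0 := by
      linear_combination e3
    have := (mul_eq_zero.mp e5).resolve_left h0
    exact ⟨by linarith, e2⟩

lemma tangent_at_double_root {X : ℝ} (hX : -1 < X) :
    (-X * g / (X + 1)) * f = (-X * f) * (-X * g / (X + 1) + g) := by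
  have h0 : X + 1 ≠ 0 := by linarith
  field_simp; ring

lemma hasExactly_inner_of_double_root (hf : f ≠ 0) {X : ℝ} (hX : -1 < X) (hX' : X < 0)
    (h : pencilDet g f c X = 0)
    (h' : -3 * f ^ 2 * X ^ 2 + 2 * (c - f ^ 2 - g ^ 2) * X + (c - 1) = 0) :
    HasExactly circ (para g f c) 0 1 0 := by
  refine hasExactly_inner_of_unique hf (commonPoints_eq_of_double_root hX h h')
    (tangent_at_double_root hX) ?_
  have : 0 < f ^ 2 := by positivity
  simp only; nlinarith

lemma hasExactly_outer_of_double_root (hf : f ≠ 0) {X : ℝ} (hX : 0 < X)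
    (h : pencilDet g f c X = 0)
    (h' : -3 * f ^ 2 * X ^ 2 + 2 * (c - f ^ 2 - g ^ 2) * X + (c - 1) = 0) :
    HasExactly circ (para g f c) 0 0 1 := by
  have hX1 : -1 < X := by linarith
  refine hasExactly_outer_of_unique hf (commonPoints_eq_of_double_root hX1 h h')
    (tangent_at_double_root hX1) ?_
  have : 0 < f ^ 2 := by positivity
  simp only; nlinarith

/-! ### Common points as roots of a quartic -/

/-- The quartic whose roots are the numbers `x + g`, for `(x, y)` a common point. -/
def quartic (g f c t : ℝ) : ℝ := (t ^ 2 + c - g ^ 2) ^ 2 + 4 * f ^ 2 * ((t - g) ^ 2 - 1)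

/-- The derivative of `quartic`. -/
def quarticDeriv (g f c t : ℝ) : ℝ := 4 * t * (t ^ 2 + c - g ^ 2) + 8 * f ^ 2 * (t - g)

/-- The point of the parabola with abscissa `t - g`. -/
noncomputable def paraPoint (g f c t : ℝ) : ℝ × ℝ := (t - g, -(t ^ 2 + c - g ^ 2) / (2 * f))

lemma paraPoint_injective : Function.Injective (paraPoint g f c) := by
  intro s t h
  have := congrArg Prod.fst h
  simp only [paraPoint] at this
  linarith

lemma commonPoints_eq_image (hf : f ≠ 0) :
    commonPoints circ (para g f c) = paraPoint g f c '' {t | quartic g f c t = 0} := by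
  ext p
  simp only [mem_commonPoints, Set.mem_image, Set.mem_ofPred_eq]
  constructor
  · rintro ⟨h1, h2⟩
    have hy : p.2 = -((p.1 + g) ^ 2 + c - g ^ 2) / (2 * f) := by
      field_simp; linear_combination h2
    refine ⟨p.1 + g, ?_, Prod.ext (by simp [paraPoint]) (by simp [paraPoint, hy])⟩
    rw [quartic]
    have h3 : (p.1 + g) ^ 2 + c - g ^ 2 = -2 * f * p.2 := by linear_combination h2
    rw [h3]; linear_combination 4 * f ^ 2 * h1
  · rintro ⟨t, ht, rfl⟩
    rw [quartic] at ht
    simp only [paraPoint]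
    constructor
    · field_simp; linear_combination ht
    · field_simp; ring

lemma paraPoint_tangent_iff (hf : f ≠ 0) (t : ℝ) :
    (paraPoint g f c t).1 * f = (paraPoint g f c t).2 * ((paraPoint g f c t).1 + g) ↔
      quarticDeriv g f c t = 0 := by
  simp only [paraPoint, quarticDeriv]
  constructor
  · intro h
    field_simp at h
    linear_combination 4 * h
  · intro h
    field_simp
    linear_combination h / 4

/-- Simple real roots of the quartic are crossings, multiple ones are tangent points; as soon as
there is a second common point, no tangent point is an outer one. -/
lemma hasExactly_of_quartic (hf : f ≠ 0) {S D : Set ℝ} {m n : ℕ}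
    (hS : ∀ t, t ∈ S ↔ quartic g f c t = 0 ∧ quarticDeriv g f c t ≠ 0)
    (hD : ∀ t, t ∈ D ↔ quartic g f c t = 0 ∧ quarticDeriv g f c t = 0)
    (hm : S.encard = m) (hn : D.encard = n) (h2 : D.Nonempty → (S ∪ D).Nontrivial) :
    HasExactly circ (para g f c) m n 0 := by
  have hcom := commonPoints_eq_image (g := g) (c := c) hf
  have hroots : {t | quartic g f c t = 0} = S ∪ D := by
    ext t
    simp only [Set.mem_ofPred_eq, Set.mem_union, hS, hD]
    tauto
  rw [hroots] at hcom
  have hcross : crossingPoints circ (para g f c) = paraPoint g f c '' S := by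
    ext p
    rw [mem_crossingPoints hf, commonPoints_eq_image hf]
    constructor
    · rintro ⟨⟨t, ht, rfl⟩, h⟩
      exact ⟨t, (hS t).mpr ⟨ht, fun h0 => h ((paraPoint_tangent_iff hf t).mpr h0)⟩, rfl⟩
    · rintro ⟨t, ht, rfl⟩
      obtain ⟨h0, h1⟩ := (hS t).mp ht
      exact ⟨⟨t, h0, rfl⟩, fun h => h1 ((paraPoint_tangent_iff hf t).mp h)⟩
  have hout : outerTangentPoints circ (para g f c) = ∅ := by
    rw [Set.eq_empty_iff_forall_notMem]
    intro p hp
    obtain ⟨hc, ht, -⟩ := (mem_outerTangentPoints hf).mp hp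
    rw [commonPoints_eq_image hf] at hc
    obtain ⟨t, ht0, rfl⟩ := hc
    have htD : t ∈ D := (hD t).mpr ⟨ht0, (paraPoint_tangent_iff hf t).mp ht⟩
    obtain ⟨s, hs, hst⟩ := (h2 ⟨t, htD⟩).exists_ne t
    have := eq_of_mem_outerTangentPoints hf hp (v := paraPoint g f c s)
      (by rw [hcom]; exact ⟨s, hs, rfl⟩)
    exact hst (paraPoint_injective this)
  have hinn : innerTangentPoints circ (para g f c) = paraPoint g f c '' D := by
    ext p
    constructor
    · intro hp
      obtain ⟨hc, ht, -⟩ := (mem_innerTangentPoints hf).mp hp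
      rw [commonPoints_eq_image hf] at hc
      obtain ⟨t, ht0, rfl⟩ := hc
      exact ⟨t, (hD t).mpr ⟨ht0, (paraPoint_tangent_iff hf t).mp ht⟩, rfl⟩
    · rintro ⟨t, ht, rfl⟩
      obtain ⟨h0, h1⟩ := (hD t).mp ht
      have hc : paraPoint g f c t ∈ commonPoints circ (para g f c) := by
        rw [commonPoints_eq_image hf]; exact ⟨t, h0, rfl⟩
      have ht' := (paraPoint_tangent_iff hf t).mpr h1
      refine (mem_innerTangentPoints hf).mpr ⟨hc, ht', ?_⟩
      have hy := snd_ne_zero_of_tangent hf (mem_commonPoints.mp hc).1 ht'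
      rcases lt_or_gt_of_ne (mul_ne_zero hy hf) with h | h
      · have : paraPoint g f c t ∈ outerTangentPoints circ (para g f c) :=
          (mem_outerTangentPoints hf).mpr ⟨hc, ht', h⟩
        rw [hout] at this
        exact this.elim
      · exact h
  have hdisj : Disjoint S D := by
    rw [Set.disjoint_left]
    intro t h1 h2
    exact ((hS t).mp h1).2 ((hD t).mp h2).2
  refine ⟨?_, ?_, ?_, ?_⟩
  · rw [hcross, paraPoint_injective.encard_image, hm]
  · rw [hinn, paraPoint_injective.encard_image, hn]
  · rw [hout]; simp
  · rw [hcom, paraPoint_injective.encard_image, Set.encard_union_eq hdisj, hm, hn]; simp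

/-! ### Factorization of the quartic -/

/-- The quartic of the common points is `(t - t₁) (t - t₂) (t - t₃) (t - t₄)`. -/
def HasRoots (g f c t₁ t₂ t₃ t₄ : ℝ) : Prop :=
  ∀ t, quartic g f c t = (t - t₁) * (t - t₂) * (t - t₃) * (t - t₄) ∧
    quarticDeriv g f c t = (t - t₂) * (t - t₃) * (t - t₄) + (t - t₁) * (t - t₃) * (t - t₄) +
      (t - t₁) * (t - t₂) * (t - t₄) + (t - t₁) * (t - t₂) * (t - t₃)

lemma HasRoots.hasExactly_four {t₁ t₂ t₃ t₄ : ℝ} (hf : f ≠ 0) (h : HasRoots g f c t₁ t₂ t₃ t₄)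
    (h12 : t₁ ≠ t₂) (h13 : t₁ ≠ t₃) (h14 : t₁ ≠ t₄) (h23 : t₂ ≠ t₃) (h24 : t₂ ≠ t₄)
    (h34 : t₃ ≠ t₄) : HasExactly circ (para g f c) 4 0 0 := by
  have k12 := sub_ne_zero.mpr h12
  have k13 := sub_ne_zero.mpr h13
  have k14 := sub_ne_zero.mpr h14
  have k23 := sub_ne_zero.mpr h23
  have k24 := sub_ne_zero.mpr h24
  have k34 := sub_ne_zero.mpr h34
  have k21 := sub_ne_zero.mpr h12.symm
  have k31 := sub_ne_zero.mpr h13.symm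
  have k41 := sub_ne_zero.mpr h14.symm
  have k32 := sub_ne_zero.mpr h23.symm
  have k42 := sub_ne_zero.mpr h24.symm
  have k43 := sub_ne_zero.mpr h34.symm
  have hz : ∀ t, quartic g f c t = 0 → t = t₁ ∨ t = t₂ ∨ t = t₃ ∨ t = t₄ := by
    intro t ht
    rw [(h t).1] at ht
    simpa [sub_eq_zero, or_assoc] using ht
  have hd : ∀ t, t = t₁ ∨ t = t₂ ∨ t = t₃ ∨ t = t₄ → quarticDeriv g f c t ≠ 0 := by
    intro t ht
    rw [(h t).2]
    rcases ht with rfl | rfl | rfl | rfl <;>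
      simp [k12, k13, k14, k21, k23, k24, k31, k32, k34, k41, k42, k43]
  refine hasExactly_of_quartic hf (S := {t₁, t₂, t₃, t₄}) (D := ∅) ?_ ?_ ?_ (by simp) (by simp)
  · intro t
    simp only [Set.mem_insert_iff, Set.mem_singleton_iff]
    refine ⟨fun ht => ⟨?_, hd t ht⟩, fun ht => hz t ht.1⟩
    rw [(h t).1]
    rcases ht with rfl | rfl | rfl | rfl <;> simp
  · intro t
    simp only [Set.mem_empty_iff_false, false_iff]
    exact fun ht => hd t (hz t ht.1) ht.2
  · rw [Set.encard_insert_of_notMem (by simp [h12, h13, h14]),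
      Set.encard_insert_of_notMem (by simp [h23, h24]), Set.encard_pair h34]
    norm_num

lemma HasRoots.hasExactly_two_one {t₁ t₃ t₄ : ℝ} (hf : f ≠ 0) (h : HasRoots g f c t₁ t₁ t₃ t₄)
    (h13 : t₁ ≠ t₃) (h14 : t₁ ≠ t₄) (h34 : t₃ ≠ t₄) : HasExactly circ (para g f c) 2 1 0 := by
  have k34 := sub_ne_zero.mpr h34
  have k31 := sub_ne_zero.mpr h13.symm
  have k41 := sub_ne_zero.mpr h14.symm
  have k43 := sub_ne_zero.mpr h34.symm
  have hz : ∀ t, quartic g f c t = 0 ↔ t = t₁ ∨ t = t₃ ∨ t = t₄ := by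
    intro t
    rw [(h t).1]
    simp [sub_eq_zero, or_assoc]
  have hd1 : quarticDeriv g f c t₁ = 0 := by simp [(h t₁).2]
  have hd : ∀ t, t = t₃ ∨ t = t₄ → quarticDeriv g f c t ≠ 0 := by
    intro t ht
    rw [(h t).2]
    rcases ht with rfl | rfl <;> simp [k31, k34, k41, k43]
  refine hasExactly_of_quartic hf (S := {t₃, t₄}) (D := {t₁}) ?_ ?_ ?_ (by simp) ?_
  · intro t
    simp only [Set.mem_insert_iff, Set.mem_singleton_iff, hz]
    refine ⟨fun ht => ⟨Or.inr ht, hd t ht⟩, ?_⟩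
    rintro ⟨rfl | ht, h'⟩
    · exact absurd hd1 h'
    · exact ht
  · intro t
    simp only [Set.mem_singleton_iff, hz]
    refine ⟨?_, ?_⟩
    · rintro rfl; exact ⟨Or.inl rfl, hd1⟩
    · rintro ⟨rfl | ht, h'⟩
      · rfl
      · exact absurd h' (hd t ht)
  · rw [Set.encard_pair h34]; norm_num
  · exact fun _ => ⟨t₃, by simp, t₄, by simp, h34⟩

lemma HasRoots.hasExactly_one_one {t₁ t₄ : ℝ} (hf : f ≠ 0) (h : HasRoots g f c t₁ t₁ t₁ t₄)
    (h14 : t₁ ≠ t₄) : HasExactly circ (para g f c) 1 1 0 := by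
  have k41 := sub_ne_zero.mpr h14.symm
  have hz : ∀ t, quartic g f c t = 0 ↔ t = t₁ ∨ t = t₄ := by
    intro t
    rw [(h t).1]
    simp [sub_eq_zero]
  have hd1 : quarticDeriv g f c t₁ = 0 := by simp [(h t₁).2]
  have hd : quarticDeriv g f c t₄ ≠ 0 := by simp [(h t₄).2, k41]
  refine hasExactly_of_quartic hf (S := {t₄}) (D := {t₁}) ?_ ?_ (by simp) (by simp) ?_
  · intro t
    simp only [Set.mem_singleton_iff, hz]
    refine ⟨?_, ?_⟩
    · rintro rfl; exact ⟨Or.inr rfl, hd⟩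
    · rintro ⟨rfl | ht, h'⟩
      · exact absurd hd1 h'
      · exact ht
  · intro t
    simp only [Set.mem_singleton_iff, hz]
    refine ⟨?_, ?_⟩
    · rintro rfl; exact ⟨Or.inl rfl, hd1⟩
    · rintro ⟨ht | rfl, h'⟩
      · exact ht
      · exact absurd h' hd
  · exact fun _ => ⟨t₁, by simp, t₄, by simp, h14⟩

lemma HasRoots.hasExactly_zero_two {t₁ t₃ : ℝ} (hf : f ≠ 0) (h : HasRoots g f c t₁ t₁ t₃ t₃)
    (h13 : t₁ ≠ t₃) : HasExactly circ (para g f c) 0 2 0 := by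
  have hz : ∀ t, quartic g f c t = 0 ↔ t = t₁ ∨ t = t₃ := by
    intro t
    rw [(h t).1]
    simp [sub_eq_zero]
  have hd : ∀ t, t = t₁ ∨ t = t₃ → quarticDeriv g f c t = 0 := by
    rintro t (rfl | rfl) <;> simp [(h _).2]
  refine hasExactly_of_quartic hf (S := ∅) (D := {t₁, t₃}) ?_ ?_ (by simp) ?_ ?_
  · intro t
    simp only [Set.mem_empty_iff_false, false_iff, hz]
    exact fun ht => ht.2 (hd t ht.1)
  · intro t
    simp only [Set.mem_insert_iff, Set.mem_singleton_iff, hz]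
    exact ⟨fun ht => ⟨ht, hd t ht⟩, fun ht => ht.1⟩
  · rw [Set.encard_pair h13]; norm_num
  · exact fun _ => ⟨t₁, by simp, t₃, by simp, h13⟩

/-- Ferrari's solution of the quartic. The three equations say that the `rᵢ - 1` are the roots of
the pencil determinant, which is the resolvent cubic; the roots of the quartic are the sums `±a₁ ±
a₂ ± a₃` with an even number of minus signs, where `aᵢ² = -f² rᵢ`. -/
lemma exists_hasRoots (hf : f ≠ 0) {r₁ r₂ r₃ : ℝ} (h1 : r₁ < 0) (h2 : r₂ < 0)
    (e1 : c + 2 * f ^ 2 - g ^ 2 = f ^ 2 * (r₁ + r₂ + r₃))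
    (e2 : 2 * g ^ 2 - 1 - c - f ^ 2 = -f ^ 2 * (r₁ * r₂ + r₁ * r₃ + r₂ * r₃))
    (e3 : -g ^ 2 = f ^ 2 * (r₁ * r₂ * r₃)) {a₁ a₂ : ℝ} (ha1 : a₁ ^ 2 = -f ^ 2 * r₁)
    (ha2 : a₂ ^ 2 = -f ^ 2 * r₂) : ∃ a₃, a₃ ^ 2 = -f ^ 2 * r₃ ∧
      HasRoots g f c (a₁ + a₂ + a₃) (a₁ - a₂ - a₃) (-a₁ + a₂ - a₃) (-a₁ - a₂ + a₃) := by
  have hf2 : 0 < f ^ 2 := by positivity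
  have ha1' : a₁ ≠ 0 := by rintro rfl; nlinarith
  have ha2' : a₂ ≠ 0 := by rintro rfl; nlinarith
  -- the sign of the third square root is fixed by the linear coefficient of the quartic
  obtain ⟨a₃, h3⟩ : ∃ a₃, a₁ * a₂ * a₃ = f ^ 2 * g := ⟨f ^ 2 * g / (a₁ * a₂), by field_simp⟩
  have ha3 : a₃ ^ 2 = -f ^ 2 * r₃ := by
    have h12 : a₁ ^ 2 * a₂ ^ 2 ≠ 0 := by positivity
    have h4 : a₁ ^ 2 * a₂ ^ 2 * a₃ ^ 2 = (f ^ 2 * g) ^ 2 := by rw [← h3]; ring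
    apply mul_left_cancel₀ h12
    rw [h4, ha1, ha2]
    linear_combination (-f ^ 4) * e3
  refine ⟨a₃, ha3, ?_⟩
  have s1 : a₁ ^ 2 + a₂ ^ 2 + a₃ ^ 2 = -(c + 2 * f ^ 2 - g ^ 2) := by
    rw [ha1, ha2, ha3]; linear_combination e1
  have s2 : a₁ ^ 2 * a₂ ^ 2 + a₁ ^ 2 * a₃ ^ 2 + a₂ ^ 2 * a₃ ^ 2 =
      -f ^ 2 * (2 * g ^ 2 - 1 - c - f ^ 2) := by
    rw [ha1, ha2, ha3]; linear_combination f ^ 2 * e2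
  intro t
  constructor
  · rw [quartic]
    linear_combination (2 * t ^ 2 - (a₁ ^ 2 + a₂ ^ 2 + a₃ ^ 2) + (c + 2 * f ^ 2 - g ^ 2)) * s1
      + 4 * s2 + 8 * t * h3
  · rw [quarticDeriv]
    linear_combination 4 * t * s1 + 8 * h3

/-- The quartic has exactly two real roots, both simple, when the pencil determinant has a
negative discriminant. -/
lemma hasExactly_two_of_disc_neg (hf : f ≠ 0)
    (h : -27 * (f ^ 2) ^ 2 * (-g ^ 2) ^ 2
      - 18 * f ^ 2 * (c + 2 * f ^ 2 - g ^ 2) * (2 * g ^ 2 - 1 - c - f ^ 2) * (-g ^ 2)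
      + (c + 2 * f ^ 2 - g ^ 2) ^ 2 * (2 * g ^ 2 - 1 - c - f ^ 2) ^ 2
      - 4 * (c + 2 * f ^ 2 - g ^ 2) ^ 3 * (-g ^ 2)
      + 4 * f ^ 2 * (2 * g ^ 2 - 1 - c - f ^ 2) ^ 3 < 0) :
    HasExactly circ (para g f c) 2 0 0 := by
  have hf2 : 0 < f ^ 2 := by positivity
  obtain ⟨r, hr⟩ := exists_root_cubic (neg_ne_zero.mpr hf2.ne') (c + 2 * f ^ 2 - g ^ 2)
    (2 * g ^ 2 - 1 - c - f ^ 2) (-g ^ 2)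
  -- the quotient of the resolvent cubic by `X - r` is `-f² X² + β X + γ`
  obtain ⟨β, hβ⟩ : ∃ β, c + 2 * f ^ 2 - g ^ 2 = β + f ^ 2 * r := ⟨_, (sub_add_cancel _ _).symm⟩
  obtain ⟨γ, hγ⟩ : ∃ γ, 2 * g ^ 2 - 1 - c - f ^ 2 = γ - r * β :=
    ⟨_, (add_sub_cancel_right _ _).symm⟩
  rw [hβ, hγ] at h hr
  have hg : -g ^ 2 = -r * γ := by linear_combination hr
  rw [hg] at h
  have hδ : β ^ 2 + 4 * f ^ 2 * γ < 0 := by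
    by_contra hneg
    push Not at hneg
    have : 0 ≤ (β ^ 2 + 4 * f ^ 2 * γ) * (-f ^ 2 * r ^ 2 + β * r + γ) ^ 2 := by positivity
    linarith
  have hγ' : 0 < -f ^ 2 * γ := by nlinarith [sq_nonneg β]
  obtain ⟨b, hb, hb2⟩ : ∃ b > 0, b ^ 2 = -f ^ 2 * γ :=
    ⟨_, Real.sqrt_pos.mpr hγ', Real.sq_sqrt hγ'.le⟩
  obtain ⟨a, ha⟩ : ∃ a, a * b = f ^ 2 * g := ⟨f ^ 2 * g / b, by field_simp⟩
  have ha2 : a ^ 2 = -f ^ 2 * r := by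
    apply mul_right_cancel₀ (pow_ne_zero 2 hb.ne')
    linear_combination (a * b + f ^ 2 * g) * ha + f ^ 2 * r * hb2 - f ^ 4 * hg
  have hD : (-β - 2 * b) * (-β + 2 * b) < 0 := by
    have : (-β - 2 * b) * (-β + 2 * b) = β ^ 2 + 4 * f ^ 2 * γ := by linear_combination -4 * hb2
    linarith
  have hD1 : -β - 2 * b < 0 := by
    by_contra hn
    push Not at hn
    have : 0 ≤ -β + 2 * b := by linarith
    nlinarith
  have hD2 : 0 < -β + 2 * b := by
    by_contra hn
    push Not at hn
    nlinarith
  have hq : ∀ t, quartic g f c t = ((t + a) ^ 2 - (-β - 2 * b)) * ((t - a) ^ 2 - (-β + 2 * b)) := by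
    intro t
    rw [quartic]
    linear_combination (2 * t ^ 2 + (c + 2 * f ^ 2 - g ^ 2) + (β + f ^ 2 * r)) * hβ
      + 4 * f ^ 2 * hγ + 8 * t * ha + (2 * t ^ 2 - a ^ 2 + f ^ 2 * r - 2 * β) * ha2 + 4 * hb2
  have hq' : ∀ t, quarticDeriv g f c t = 2 * (t + a) * ((t - a) ^ 2 - (-β + 2 * b)) +
      2 * (t - a) * ((t + a) ^ 2 - (-β - 2 * b)) := by
    intro t
    rw [quarticDeriv]
    linear_combination 4 * t * hβ + 8 * ha + 4 * t * ha2
  obtain ⟨w, hw, hw2⟩ : ∃ w > 0, w ^ 2 = -β + 2 * b :=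
    ⟨_, Real.sqrt_pos.mpr hD2, Real.sq_sqrt hD2.le⟩
  rw [← hw2] at hq hq'
  have hpos : ∀ t, (t + a) ^ 2 - (-β - 2 * b) ≠ 0 := fun t => by
    have := sq_nonneg (t + a); intro h0; linarith
  have hz : ∀ t, quartic g f c t = 0 ↔ t = a + w ∨ t = a - w := by
    intro t
    have e : (t - a) ^ 2 - w ^ 2 = (t - (a + w)) * (t - (a - w)) := by ring
    rw [hq, mul_eq_zero, or_iff_right (hpos t), e, mul_eq_zero, sub_eq_zero, sub_eq_zero]
  have hd : ∀ t, t = a + w ∨ t = a - w → quarticDeriv g f c t ≠ 0 := by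
    rintro t (rfl | rfl) <;> rw [hq']
    · have := mul_ne_zero (mul_ne_zero two_ne_zero hw.ne') (hpos (a + w))
      intro h0; apply this; linear_combination h0
    · have := mul_ne_zero (mul_ne_zero two_ne_zero hw.ne') (hpos (a - w))
      intro h0; apply this; linear_combination -h0
  refine hasExactly_of_quartic hf (S := {a + w, a - w}) (D := ∅) ?_ ?_ ?_ (by simp) (by simp)
  · intro t
    simp only [Set.mem_insert_iff, Set.mem_singleton_iff, hz]
    exact ⟨fun ht => ⟨ht, hd t ht⟩, fun ht => ht.1⟩
  · intro t
    simp only [Set.mem_empty_iff_false, false_iff, hz]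
    exact fun ht => hd t ht.1 ht.2
  · rw [Set.encard_pair (by intro h0; linarith)]; norm_num

end ConicPosition

/-! ### Invariants of the circle and the parabola -/

namespace ConicPosition

open scoped Matrix

variable {g f c : ℝ}

lemma L1_eq {M N : Matrix (Fin 3) (Fin 3) ℝ} (h : N.det ≠ 0) :
    L1 M N = (N.adjugate * M).trace := by
  rw [L1, L0, Matrix.inv_def, Matrix.smul_mul, Matrix.trace_smul, smul_eq_mul, ← mul_assoc,
    Ring.mul_inverse_cancel _ h.isUnit, one_mul]

lemma L2_eq {M N : Matrix (Fin 3) (Fin 3) ℝ} (h : M.det ≠ 0) :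
    L2 M N = (M.adjugate * N).trace := L1_eq h

lemma T_eq {M N : Matrix (Fin 3) (Fin 3) ℝ} (h : (quadPart M).det ≠ 0) :
    T M N = ((quadPart M).adjugate * quadPart N).trace := by
  rw [T, T1, Matrix.inv_def, Matrix.smul_mul, Matrix.trace_smul, smul_eq_mul, ← mul_assoc,
    Ring.mul_inverse_cancel _ h.isUnit, one_mul]

lemma L0_para : L0 (para g f c) = -f ^ 2 := by
  simp [L0, para, Matrix.det_fin_three]; ring

lemma L3_circ : L3 circ = -1 := by
  simp [L3, circ, Matrix.det_fin_three]

lemma T1_circ : T1 circ = 1 := by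
  simp [T1, circ, quadPart, Matrix.det_fin_two]

lemma L1_para (hf : f ≠ 0) : L1 circ (para g f c) = c - f ^ 2 - g ^ 2 := by
  have : (para g f c).det ≠ 0 := by
    have := L0_para (g := g) (f := f) (c := c)
    rw [L0] at this; rw [this]; simpa using hf
  rw [L1_eq this, Matrix.adjugate_fin_three]
  simp [para, circ, Matrix.trace, Fin.sum_univ_three]; ring

lemma L2_para : L2 circ (para g f c) = c - 1 := by
  have : circ.det ≠ 0 := by
    have := L3_circ
    rw [L3] at this; rw [this]; norm_num
  rw [L2_eq this, Matrix.adjugate_fin_three]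
  simp [para, circ, Matrix.trace, Fin.sum_univ_three]; ring

lemma T_para : T circ (para g f c) = 1 := by
  have : (quadPart circ).det ≠ 0 := by
    have := T1_circ
    rw [T1] at this; rw [this]; norm_num
  rw [T_eq this, Matrix.adjugate_fin_two]
  simp [para, circ, quadPart, Matrix.trace, Fin.sum_univ_two]

lemma I2_para : I2 circ (para g f c) = f ^ 2 - 1 := by
  rw [I2, L0_para, L3_circ, T1_circ, T_para]; ring

lemma I3_para (hf : f ≠ 0) : I3 circ (para g f c) = -g ^ 2 := by
  rw [I3, L0_para, L3_circ, T1_circ, T_para, L1_para hf, L2_para]; ring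

lemma I4_para (hf : f ≠ 0) : I4 circ (para g f c) = 2 * g ^ 2 - 1 - c - f ^ 2 := by
  rw [I4, L0_para, T1_circ, T_para, L1_para hf, L2_para]; ring

lemma I5_para (hf : f ≠ 0) : I5 circ (para g f c) = c + 2 * f ^ 2 - g ^ 2 := by
  rw [I5, L0_para, T1_circ, T_para, L1_para hf]; ring

/-- The discriminants of the pencil determinant in the variables `X` and `X + 1` agree. -/
lemma disc_para (hf : f ≠ 0) : disc circ (para g f c) =
    -27 * (f ^ 2) ^ 2 * (-g ^ 2) ^ 2
      - 18 * f ^ 2 * (c + 2 * f ^ 2 - g ^ 2) * (2 * g ^ 2 - 1 - c - f ^ 2) * (-g ^ 2)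
      + (c + 2 * f ^ 2 - g ^ 2) ^ 2 * (2 * g ^ 2 - 1 - c - f ^ 2) ^ 2
      - 4 * (c + 2 * f ^ 2 - g ^ 2) ^ 3 * (-g ^ 2)
      + 4 * f ^ 2 * (2 * g ^ 2 - 1 - c - f ^ 2) ^ 3 := by
  rw [disc, L0_para, L3_circ, L1_para hf, L2_para]; ring

lemma disc'_para (hf : f ≠ 0) : disc' circ (para g f c) =
    4 * (c + 2 * f ^ 2 - g ^ 2) ^ 2 + 12 * f ^ 2 * (2 * g ^ 2 - 1 - c - f ^ 2) := by
  rw [disc', L0_para, L1_para hf, L2_para]; ring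

/-- The `rᵢ`, in increasing order, are the numbers `X + 1`, for `X` a root of the pencil
determinant. The three equations compute `I5`, `I4` and `I3`. -/
structure PencilRoots (g f c r₁ r₂ r₃ : ℝ) : Prop where
  le₁ : r₁ ≤ r₂
  le₂ : r₂ ≤ r₃
  e₁ : c + 2 * f ^ 2 - g ^ 2 = f ^ 2 * (r₁ + r₂ + r₃)
  e₂ : 2 * g ^ 2 - 1 - c - f ^ 2 = -f ^ 2 * (r₁ * r₂ + r₁ * r₃ + r₂ * r₃)
  e₃ : -g ^ 2 = f ^ 2 * (r₁ * r₂ * r₃)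

lemma exists_pencilRoots (hf : f ≠ 0) (h : 0 ≤ disc circ (para g f c)) :
    ∃ r₁ r₂ r₃, PencilRoots g f c r₁ r₂ r₃ := by
  rw [disc_para hf] at h
  obtain ⟨r, s, t, h1, h2, h3, h4, h5⟩ := exists_roots_cubic (pow_ne_zero 2 hf) _ _ _ h
  exact ⟨r, s, t, h1, h2, h3, h4, h5⟩

namespace PencilRoots

variable {r₁ r₂ r₃ : ℝ}

lemma disc_eq (h : PencilRoots g f c r₁ r₂ r₃) (hf : f ≠ 0) : disc circ (para g f c) =
    (f ^ 2) ^ 4 * ((r₁ - r₂) * (r₁ - r₃) * (r₂ - r₃)) ^ 2 := by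
  rw [disc_para hf, h.e₁, h.e₂, h.e₃]; ring

lemma disc'_eq (h : PencilRoots g f c r₁ r₂ r₃) (hf : f ≠ 0) : disc' circ (para g f c) =
    2 * (f ^ 2) ^ 2 * ((r₁ - r₂) ^ 2 + (r₁ - r₃) ^ 2 + (r₂ - r₃) ^ 2) := by
  rw [disc'_para hf, h.e₁, h.e₂]; ring

lemma pencilDet_eq (h : PencilRoots g f c r₁ r₂ r₃) (X : ℝ) :
    pencilDet g f c X = -f ^ 2 * ((X + 1 - r₁) * (X + 1 - r₂) * (X + 1 - r₃)) := by
  rw [pencilDet]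
  linear_combination (X + 1) ^ 2 * h.e₁ + (X + 1) * h.e₂ + h.e₃

lemma pencilDet_deriv_eq (h : PencilRoots g f c r₁ r₂ r₃) (X : ℝ) :
    -3 * f ^ 2 * X ^ 2 + 2 * (c - f ^ 2 - g ^ 2) * X + (c - 1) =
      -f ^ 2 * ((X + 1 - r₁) * (X + 1 - r₂) + (X + 1 - r₁) * (X + 1 - r₃) +
        (X + 1 - r₂) * (X + 1 - r₃)) := by
  linear_combination 2 * (X + 1) * h.e₁ + h.e₂

lemma lt_of_disc_pos (h : PencilRoots g f c r₁ r₂ r₃) (hf : f ≠ 0)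
    (hd : 0 < disc circ (para g f c)) : r₁ < r₂ ∧ r₂ < r₃ := by
  rw [h.disc_eq hf] at hd
  refine ⟨lt_of_le_of_ne h.le₁ ?_, lt_of_le_of_ne h.le₂ ?_⟩ <;> rintro rfl <;> simp at hd

lemma eq_or_eq_of_disc_zero (h : PencilRoots g f c r₁ r₂ r₃) (hf : f ≠ 0)
    (hd : disc circ (para g f c) = 0) : r₁ = r₂ ∨ r₂ = r₃ := by
  rw [h.disc_eq hf] at hd
  have h1 := h.le₁
  have h2 := h.le₂
  simp only [mul_eq_zero, pow_eq_zero_iff, ne_eq, OfNat.ofNat_ne_zero, not_false_eq_true, hf,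
    false_or, sub_eq_zero] at hd
  rcases hd with (h' | h') | h'
  · exact Or.inl h'
  · left; linarith
  · exact Or.inr h'

lemma prod_nonpos (h : PencilRoots g f c r₁ r₂ r₃) (hf : f ≠ 0) : r₁ * r₂ * r₃ ≤ 0 := by
  have hf2 : 0 < f ^ 2 := by positivity
  have := h.e₃
  nlinarith [sq_nonneg g]

/-- Descartes' rule for the three real roots `X = rᵢ - 1`, whose product is negative. -/
lemma one_lt (h : PencilRoots g f c r₁ r₂ r₃) (hf : f ≠ 0)
    (hL : 0 < c - f ^ 2 - g ^ 2 ∨ 0 < c - 1) : r₁ < 1 ∧ 1 < r₂ := by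
  have hf2 : 0 < f ^ 2 := by positivity
  have h1 := h.le₁
  have h2 := h.le₂
  have e0 := h.pencilDet_eq 0
  have d0 := h.pencilDet_deriv_eq 0
  have hs : c - f ^ 2 - g ^ 2 = f ^ 2 * ((r₁ - 1) + (r₂ - 1) + (r₃ - 1)) := by
    linear_combination h.e₁
  have hprod : (r₁ - 1) * (r₂ - 1) * (r₃ - 1) < 0 := by
    rw [pencilDet] at e0
    nlinarith
  have hk : 0 < (r₁ - 1) + (r₂ - 1) + (r₃ - 1) ∨
      (r₁ - 1) * (r₂ - 1) + (r₁ - 1) * (r₃ - 1) + (r₂ - 1) * (r₃ - 1) < 0 := by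
    rcases hL with hL | hL
    · left; rw [hs] at hL; exact pos_of_mul_pos_right hL hf2.le
    · right; nlinarith
  obtain ⟨u, hu⟩ : ∃ u, u = r₁ - 1 := ⟨_, rfl⟩
  obtain ⟨v, hv⟩ : ∃ v, v = r₂ - 1 := ⟨_, rfl⟩
  obtain ⟨w, hw⟩ : ∃ w, w = r₃ - 1 := ⟨_, rfl⟩
  rw [← hu, ← hv, ← hw] at hprod hk
  have huv : u ≤ v := by linarith
  have hvw : v ≤ w := by linarith
  suffices u < 0 ∧ 0 < v by constructor <;> linarith
  have hv0 : 0 < v := by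
    by_contra hn
    push Not at hn
    have huv0 : 0 ≤ u * v := mul_nonneg_of_nonpos_of_nonpos (by linarith) hn
    have hw0 : w < 0 := by
      by_contra hw0
      push Not at hw0
      nlinarith [mul_nonneg huv0 hw0]
    rcases hk with hk | hk <;> nlinarith
  refine ⟨?_, hv0⟩
  by_contra hn
  push Not at hn
  have : 0 ≤ u * v * w := by
    have : 0 ≤ w := by linarith
    positivity
  linarith

/-- A cubic with negative leading coefficient and constant term and no positive coefficient has no
nonnegative root. -/
lemma lt_one (h : PencilRoots g f c r₁ r₂ r₃) (hf : f ≠ 0)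
    (hL1 : c - f ^ 2 - g ^ 2 ≤ 0) (hL2 : c - 1 ≤ 0) : r₃ < 1 := by
  have hf2 : 0 < f ^ 2 := by positivity
  by_contra hn
  push Not at hn
  have e := h.pencilDet_eq (r₃ - 1)
  rw [sub_add_cancel, sub_self, mul_zero, mul_zero, pencilDet] at e
  have hu : 0 ≤ r₃ - 1 := by linarith
  have e1 : 0 ≤ f ^ 2 * (r₃ - 1) ^ 3 := by positivity
  have e2 : 0 ≤ (-(c - f ^ 2 - g ^ 2)) * (r₃ - 1) ^ 2 := mul_nonneg (by linarith) (sq_nonneg _)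
  have e3 : 0 ≤ (-(c - 1)) * (r₃ - 1) := mul_nonneg (by linarith) hu
  linarith

/-- The pencil determinant is positive between its two largest roots. -/
lemma separated (h : PencilRoots g f c r₁ r₂ r₃) (hf : f ≠ 0) (h1 : r₁ < 1) (h2 : 1 < r₂)
    (h23 : r₂ < r₃) : Separated circ (para g f c) := by
  have hf2 : 0 < f ^ 2 := by positivity
  refine separated_of_pencilDet_pos (X := (r₂ + r₃) / 2 - 1) (by linarith) ?_
  rw [h.pencilDet_eq]
  have : 0 < (r₂ + r₃) / 2 - r₁ := by linarith
  have e : -f ^ 2 * (((r₂ + r₃) / 2 - 1 + 1 - r₁) * ((r₂ + r₃) / 2 - 1 + 1 - r₂) *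
    ((r₂ + r₃) / 2 - 1 + 1 - r₃)) = f ^ 2 * (((r₂ + r₃) / 2 - r₁) * ((r₃ - r₂) ^ 2 / 4)) := by ring
  rw [e]
  have : 0 < r₃ - r₂ := by linarith
  positivity

lemma isInside (h : PencilRoots g f c r₁ r₂ r₃) (hf : f ≠ 0) (h1 : r₁ < r₂) (h2 : 0 ≤ r₂)
    (h23 : r₂ < r₃) (h3 : r₃ < 1) : IsInside circ (para g f c) := by
  have hf2 : 0 < f ^ 2 := by positivity
  refine isInside_of_pencilDet_pos (X := (r₂ + r₃) / 2 - 1) (by linarith) (by linarith) ?_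
  rw [h.pencilDet_eq]
  have : 0 < (r₂ + r₃) / 2 - r₁ := by linarith
  have e : -f ^ 2 * (((r₂ + r₃) / 2 - 1 + 1 - r₁) * ((r₂ + r₃) / 2 - 1 + 1 - r₂) *
    ((r₂ + r₃) / 2 - 1 + 1 - r₃)) = f ^ 2 * (((r₂ + r₃) / 2 - r₁) * ((r₃ - r₂) ^ 2 / 4)) := by ring
  rw [e]
  have : 0 < r₃ - r₂ := by linarith
  positivity

lemma externallyTangent (h : PencilRoots g f c r₁ r₂ r₃) (hf : f ≠ 0) (h2 : 1 < r₂)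
    (h23 : r₂ = r₃) : ExternallyTangent circ (para g f c) := by
  subst h23
  refine hasExactly_outer_of_double_root (X := r₂ - 1) hf (by linarith) ?_ ?_
  · rw [h.pencilDet_eq]; ring
  · rw [h.pencilDet_deriv_eq]; ring

lemma hasExactly_inner (h : PencilRoots g f c r₁ r₂ r₃) (hf : f ≠ 0) (h2 : 0 < r₂)
    (h23 : r₂ = r₃) (h3 : r₃ < 1) : HasExactly circ (para g f c) 0 1 0 := by
  subst h23
  refine hasExactly_inner_of_double_root (X := r₂ - 1) hf (by linarith) (by linarith) ?_ ?_
  · rw [h.pencilDet_eq]; ring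
  · rw [h.pencilDet_deriv_eq]; ring

lemma sum_pos (h : PencilRoots g f c r₁ r₂ r₃) (hf : f ≠ 0) (h5 : 0 < I5 circ (para g f c)) :
    0 < r₁ + r₂ + r₃ := by
  rw [I5_para hf, h.e₁] at h5
  exact pos_of_mul_pos_right h5 (sq_nonneg f)

lemma sum_nonneg (h : PencilRoots g f c r₁ r₂ r₃) (hf : f ≠ 0) (h5 : 0 ≤ I5 circ (para g f c)) :
    0 ≤ r₁ + r₂ + r₃ := by
  rw [I5_para hf, h.e₁] at h5
  exact nonneg_of_mul_nonneg_right h5 (by positivity)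

lemma sum_neg (h : PencilRoots g f c r₁ r₂ r₃) (hf : f ≠ 0) (h5 : I5 circ (para g f c) < 0) :
    r₁ + r₂ + r₃ < 0 := by
  rw [I5_para hf, h.e₁] at h5
  exact neg_of_mul_neg_right h5 (sq_nonneg f)

lemma pairs_neg (h : PencilRoots g f c r₁ r₂ r₃) (hf : f ≠ 0) (h4 : 0 < I4 circ (para g f c)) :
    r₁ * r₂ + r₁ * r₃ + r₂ * r₃ < 0 := by
  rw [I4_para hf, h.e₂] at h4
  have : 0 < f ^ 2 := by positivity
  nlinarith

lemma pairs_pos (h : PencilRoots g f c r₁ r₂ r₃) (hf : f ≠ 0) (h4 : I4 circ (para g f c) < 0) :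
    0 < r₁ * r₂ + r₁ * r₃ + r₂ * r₃ := by
  rw [I4_para hf, h.e₂] at h4
  have : 0 < f ^ 2 := by positivity
  nlinarith

lemma prod_neg (h : PencilRoots g f c r₁ r₂ r₃) (hf : f ≠ 0) (h3 : I3 circ (para g f c) < 0) :
    r₁ * r₂ * r₃ < 0 := by
  rw [I3_para hf, h.e₃] at h3
  exact neg_of_mul_neg_right h3 (sq_nonneg f)

lemma prod_zero (h : PencilRoots g f c r₁ r₂ r₃) (hf : f ≠ 0) (h3 : I3 circ (para g f c) = 0) :
    r₁ * r₂ * r₃ = 0 := by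
  rw [I3_para hf, h.e₃] at h3
  simpa [hf, or_assoc] using h3

lemma nonneg_of_pairs_neg (h : PencilRoots g f c r₁ r₂ r₃) (hf : f ≠ 0)
    (hk : r₁ * r₂ + r₁ * r₃ + r₂ * r₃ < 0) : 0 ≤ r₂ := by
  have hp := h.prod_nonpos hf
  have h1 := h.le₁
  have h2 := h.le₂
  by_contra hn
  push Not at hn
  have h12 : 0 < r₁ * r₂ := mul_pos_of_neg_of_neg (by linarith) hn
  have h3 : r₃ ≤ 0 := nonpos_of_mul_nonpos_right hp h12
  nlinarith

lemma nonneg_of_sum_nonneg (h : PencilRoots g f c r₁ r₂ r₃) (hf : f ≠ 0)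
    (hk : 0 ≤ r₁ + r₂ + r₃) : 0 ≤ r₂ := by
  have hp := h.prod_nonpos hf
  have h1 := h.le₁
  by_contra hn
  push Not at hn
  have h12 : 0 < r₁ * r₂ := mul_pos_of_neg_of_neg (by linarith) hn
  have h3 : r₃ ≤ 0 := nonpos_of_mul_nonpos_right hp h12
  linarith

lemma nonpos_of_pairs_pos (h : PencilRoots g f c r₁ r₂ r₃) (hf : f ≠ 0)
    (hk : 0 < r₁ * r₂ + r₁ * r₃ + r₂ * r₃) (hs : r₁ + r₂ + r₃ < 0) : r₂ < 0 ∧ r₃ ≤ 0 := by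
  have hp := h.prod_nonpos hf
  have h1 := h.le₁
  have h2 := h.le₂
  have h3 : r₃ ≤ 0 := by
    by_contra hn
    push Not at hn
    have h12 : r₁ * r₂ ≤ 0 := nonpos_of_mul_nonpos_left hp hn
    nlinarith
  refine ⟨lt_of_le_of_ne (h2.trans h3) ?_, h3⟩
  rintro rfl
  obtain rfl : r₃ = 0 := le_antisymm h3 h2
  simp at hk

lemma hasExactly_four (h : PencilRoots g f c r₁ r₂ r₃) (hf : f ≠ 0) (h1 : r₁ < r₂) (h2 : r₂ < 0)
    (h23 : r₂ < r₃) : HasExactly circ (para g f c) 4 0 0 := by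
  have hf2 : 0 < f ^ 2 := by positivity
  have q1 := Real.sq_sqrt (show 0 ≤ -f ^ 2 * r₁ by nlinarith)
  have q2 := Real.sq_sqrt (show 0 ≤ -f ^ 2 * r₂ by nlinarith)
  obtain ⟨a₃, q3, hr⟩ := exists_hasRoots hf (h1.trans h2) h2 h.e₁ h.e₂ h.e₃ q1 q2
  have hne : ∀ {a b r s : ℝ}, a ^ 2 = -f ^ 2 * r → b ^ 2 = -f ^ 2 * s → r < s →
      a + b ≠ 0 ∧ a - b ≠ 0 := by
    intro a b r s ha hb hrs
    rw [← mul_ne_zero_iff]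
    have : (a + b) * (a - b) = f ^ 2 * (s - r) := by linear_combination ha - hb
    rw [this]
    exact (mul_pos hf2 (by linarith)).ne'
  obtain ⟨m12, n12⟩ := hne q1 q2 h1
  obtain ⟨m13, n13⟩ := hne q1 q3 (h1.trans h23)
  obtain ⟨m23, n23⟩ := hne q2 q3 h23
  refine hr.hasExactly_four hf ?_ ?_ ?_ ?_ ?_ ?_ <;> intro h0
  · exact m23 (by linarith)
  · exact m13 (by linarith)
  · exact m12 (by linarith)
  · exact n12 (by linarith)
  · exact n13 (by linarith)
  · exact n23 (by linarith)

lemma hasExactly_two_one (h : PencilRoots g f c r₁ r₂ r₃) (hf : f ≠ 0) (h2 : r₂ < 0)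
    (hne : r₁ ≠ r₃) (heq : r₁ = r₂ ∨ r₂ = r₃) : HasExactly circ (para g f c) 2 1 0 := by
  have hf2 : 0 < f ^ 2 := by positivity
  -- the factorization is symmetric in the `rᵢ`; the double one is put first
  obtain ⟨r, s, hr, hrs, e1, e2, e3⟩ : ∃ r s, r < 0 ∧ r ≠ s ∧
      c + 2 * f ^ 2 - g ^ 2 = f ^ 2 * (r + r + s) ∧
      2 * g ^ 2 - 1 - c - f ^ 2 = -f ^ 2 * (r * r + r * s + r * s) ∧
      -g ^ 2 = f ^ 2 * (r * r * s) := by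
    rcases heq with rfl | rfl
    · exact ⟨_, _, h2, hne, h.e₁, h.e₂, h.e₃⟩
    · exact ⟨_, _, h2, hne.symm, by rw [h.e₁]; ring, by rw [h.e₂]; ring, by rw [h.e₃]; ring⟩
  have k : 0 < -f ^ 2 * r := by nlinarith
  have hsq := Real.sq_sqrt k.le
  have hpos := Real.sqrt_pos.mpr k
  obtain ⟨b, hb, hroots⟩ := exists_hasRoots hf hr hr e1 e2 e3 hsq hsq
  generalize √(-f ^ 2 * r) = a at *
  have hab : (a + b) * (a - b) ≠ 0 := by
    have : (a + b) * (a - b) = f ^ 2 * (s - r) := by linear_combination hsq - hb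
    rw [this]
    exact mul_ne_zero hf2.ne' (sub_ne_zero.mpr hrs.symm)
  obtain ⟨m, n⟩ := mul_ne_zero_iff.mp hab
  have hroots' : HasRoots g f c (-b) (-b) (a + a + b) (-a - a + b) := by
    intro t
    obtain ⟨u, v⟩ := hroots t
    exact ⟨by rw [u]; ring, by rw [v]; ring⟩
  refine hroots'.hasExactly_two_one hf ?_ ?_ ?_ <;> intro h0
  · exact m (by linarith)
  · exact n (by linarith)
  · linarith

lemma hasExactly_one_one (h : PencilRoots g f c r₁ r₁ r₁) (hf : f ≠ 0) (h1 : r₁ < 0) :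
    HasExactly circ (para g f c) 1 1 0 := by
  have hf2 : 0 < f ^ 2 := by positivity
  have k : 0 < -f ^ 2 * r₁ := by nlinarith
  have q1 := Real.sq_sqrt k.le
  have p1 := Real.sqrt_pos.mpr k
  obtain ⟨b, q3, hr⟩ := exists_hasRoots hf h1 h1 h.e₁ h.e₂ h.e₃ q1 q1
  generalize √(-f ^ 2 * r₁) = a at *
  have hr' : HasRoots g f c (-b) (-b) (a + a + b) (-a - a + b) := by
    intro t
    obtain ⟨u, v⟩ := hr t
    exact ⟨by rw [u]; ring, by rw [v]; ring⟩
  rcases sq_eq_sq_iff_eq_or_eq_neg.mp (q3.trans q1.symm) with rfl | rfl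
  · have hr'' : HasRoots g f c (-b) (-b) (-b) (3 * b) := by
      intro t
      obtain ⟨u, v⟩ := hr' t
      exact ⟨by rw [u]; ring, by rw [v]; ring⟩
    exact hr''.hasExactly_one_one hf (by intro h0; linarith)
  · have hr'' : HasRoots g f c a a a (-3 * a) := by
      intro t
      obtain ⟨u, v⟩ := hr' t
      exact ⟨by rw [u]; ring, by rw [v]; ring⟩
    exact hr''.hasExactly_one_one hf (by intro h0; linarith)

end PencilRoots

end ConicPosition

/-! ### Classification for the circle and the parabola -/

namespace ConicPosition

open scoped Matrix

variable {g f c : ℝ}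

/-- Sign conditions that cover all cases and imply mutually exclusive positions characterize
those positions. -/
lemma iff_of_exhaustive_of_exclusive {ι : Type*} {A B : ι → Prop} (hBA : ∀ i, B i → A i)
    (hB : ∃ i, B i) (hA : ∀ i j, A i → A j → i = j) (i : ι) : A i ↔ B i := by
  refine ⟨fun h => ?_, hBA i⟩
  obtain ⟨j, hj⟩ := hB
  rwa [hA i j h (hBA j hj)]

lemma Separated.hasExactly {M N : Matrix (Fin 3) (Fin 3) ℝ} (h : Separated M N) :
    HasExactly M N 0 0 0 := by
  have h0 : commonPoints M N = ∅ := by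
    rw [Set.eq_empty_iff_forall_notMem]
    rintro p ⟨h1, h2⟩
    exact Set.disjoint_left.mp h (Or.inr h1) (Or.inr h2)
  simp [HasExactly, crossingPoints, innerTangentPoints, outerTangentPoints, h0]

lemma IsInside.hasExactly {M N : Matrix (Fin 3) (Fin 3) ℝ} (h : IsInside M N) :
    HasExactly M N 0 0 0 := by
  have h0 : commonPoints M N = ∅ := by
    rw [Set.eq_empty_iff_forall_notMem]
    rintro p ⟨h1, h2⟩
    have h3 : conicValue N p < 0 := h (Or.inr h1)
    have h4 : conicValue N p = 0 := h2
    linarith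
  simp [HasExactly, crossingPoints, innerTangentPoints, outerTangentPoints, h0]

lemma not_separated_of_isInside {N : Matrix (Fin 3) (Fin 3) ℝ} (h : IsInside circ N) :
    ¬ Separated circ N := by
  intro hs
  have h0 : ((0, 0) : ℝ × ℝ) ∈ inside circ := by
    change conicValue circ (0, 0) < 0
    rw [conicValue_circ]; norm_num
  exact Set.disjoint_left.mp hs (Or.inl h0) (Or.inl (h (Or.inl h0)))

lemma HasExactly.unique {M N : Matrix (Fin 3) (Fin 3) ℝ} {a b d a' b' d' : ℕ}
    (h : HasExactly M N a b d) (h' : HasExactly M N a' b' d') : a = a' ∧ b = b' ∧ d = d' := by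
  obtain ⟨h1, h2, h3, -⟩ := h
  obtain ⟨h1', h2', h3', -⟩ := h'
  exact ⟨by exact_mod_cast h1.symm.trans h1', by exact_mod_cast h2.symm.trans h2',
    by exact_mod_cast h3.symm.trans h3'⟩

/-- The nine relative positions. -/
def Position (M N : Matrix (Fin 3) (Fin 3) ℝ) : Fin 9 → Prop :=
  ![Separated M N, ExternallyTangent M N, IsInside M N, HasExactly M N 2 0 0, HasExactly M N 4 0 0,
    HasExactly M N 2 1 0, HasExactly M N 0 1 0, HasExactly M N 0 2 0, HasExactly M N 1 1 0]

/-- The sign conditions on the invariants, one for each relative position. -/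
def SignCondition (M N : Matrix (Fin 3) (Fin 3) ℝ) : Fin 9 → Prop :=
  ![0 < disc M N ∧ (0 < L1 M N ∨ 0 < L2 M N),
    disc M N = 0 ∧ (0 < L1 M N ∨ 0 < L2 M N),
    (0 < disc M N ∧ L1 M N < 0 ∧ L2 M N < 0 ∧ 0 < I4 M N) ∨
      (0 < disc M N ∧ L1 M N < 0 ∧ L2 M N < 0 ∧ 0 ≤ I5 M N ∧ I4 M N ≤ 0 ∧ I3 M N ≤ 0) ∨
      (I3 M N = 0 ∧ I4 M N = 0 ∧ 0 < I5 M N),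
    disc M N < 0,
    0 < disc M N ∧ I4 M N < 0 ∧ I5 M N < 0,
    I2 M N ≤ 0 ∧ disc M N = 0 ∧ disc' M N ≠ 0 ∧ I4 M N < 0 ∧ I5 M N < 0,
    (disc M N = 0 ∧ L1 M N < 0 ∧ L2 M N < 0 ∧ I3 M N < 0 ∧ (0 < I4 M N ∨ 0 < I5 M N)) ∨
      (disc M N = 0 ∧ L1 M N < 0 ∧ L2 M N < 0 ∧ I3 M N = 0 ∧ 0 < I5 M N ∧ I4 M N < 0) ∨
      (I3 M N = 0 ∧ I5 M N = 0 ∧ I4 M N = 0),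
    I3 M N = 0 ∧ I4 M N = 0 ∧ I5 M N < 0,
    disc M N = 0 ∧ disc' M N = 0 ∧ I3 M N < 0 ∧ I5 M N < 0]

lemma position_exclusive {N : Matrix (Fin 3) (Fin 3) ℝ} (i j : Fin 9) (hi : Position circ N i)
    (hj : Position circ N j) : i = j := by
  -- the numbers of the three kinds of common points, and a tag telling apart the two positions
  -- without common points
  let σ : Fin 9 → ℕ × ℕ × ℕ × ℕ :=
    ![(0, 0, 0, 0), (0, 0, 1, 0), (0, 0, 0, 1), (2, 0, 0, 0), (4, 0, 0, 0), (2, 1, 0, 0),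
      (0, 1, 0, 0), (0, 2, 0, 0), (1, 1, 0, 0)]
  have hcount : ∀ k, Position circ N k → HasExactly circ N (σ k).1 (σ k).2.1 (σ k).2.2.1 := by
    intro k hk
    fin_cases k
    · exact Separated.hasExactly hk
    · exact hk
    · exact IsInside.hasExactly hk
    all_goals exact hk
  have htag : (σ i).2.2.2 = (σ j).2.2.2 := by
    by_contra hne
    obtain ⟨e1, e2, e3⟩ := (hcount i hi).unique (hcount j hj)
    have : (i = 0 ∧ j = 2) ∨ (i = 2 ∧ j = 0) := by
      revert e1 e2 e3 hne
      clear hi hj hcount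
      revert i j
      decide
    rcases this with ⟨rfl, rfl⟩ | ⟨rfl, rfl⟩
    · exact not_separated_of_isInside hj hi
    · exact not_separated_of_isInside hi hj
  obtain ⟨e1, e2, e3⟩ := (hcount i hi).unique (hcount j hj)
  revert e1 e2 e3 htag
  clear hi hj hcount
  revert i j
  decide

/-- The axis of the parabola passes through the centre of the circle, the quartic is `(t² + I5)²`,
and the pencil determinant has the double root `X = -1`, at which `X N + M` is degenerate. -/
lemma isInside_of_centered (hf : f ≠ 0) (h3 : I3 circ (para g f c) = 0)
    (h4 : I4 circ (para g f c) = 0) (h5 : 0 < I5 circ (para g f c)) :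
    IsInside circ (para g f c) := by
  rw [I3_para hf] at h3
  rw [I4_para hf] at h4
  rw [I5_para hf] at h5
  have hg : g = 0 := by simpa using h3
  subst hg
  obtain rfl : c = -1 - f ^ 2 := by linarith
  have hp : 1 < f ^ 2 := by linarith
  -- here `pencilDet` is `(X + 1)² (f² - 1 - f² (X + 1))`
  refine isInside_of_pencilDet_pos (X := -1 + (f ^ 2 - 1) / (2 * f ^ 2)) ?_ ?_ ?_
  · have : 0 < (f ^ 2 - 1) / (2 * f ^ 2) := div_pos (by linarith) (by linarith)
    linarith
  · have : (f ^ 2 - 1) / (2 * f ^ 2) < 1 := by rw [div_lt_one (by linarith)]; linarith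
    linarith
  · have e : pencilDet 0 f (-1 - f ^ 2) (-1 + (f ^ 2 - 1) / (2 * f ^ 2)) =
        ((f ^ 2 - 1) / (2 * f ^ 2)) ^ 2 * ((f ^ 2 - 1) / 2) := by
      rw [pencilDet]; field_simp; ring
    rw [e]
    have : 0 < f ^ 2 - 1 := by linarith
    positivity

/-- The parabola is `x² + 2 f y = 2` with `f² = 1`, which meets the circle at `(0, f)` only, with
multiplicity four. -/
lemma hasExactly_inner_of_osculating (hf : f ≠ 0) (h3 : I3 circ (para g f c) = 0)
    (h5 : I5 circ (para g f c) = 0) (h4 : I4 circ (para g f c) = 0) :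
    HasExactly circ (para g f c) 0 1 0 := by
  rw [I3_para hf] at h3
  rw [I4_para hf] at h4
  rw [I5_para hf] at h5
  have hg : g = 0 := by simpa using h3
  subst hg
  obtain rfl : c = -2 := by linarith
  have hp : f ^ 2 = 1 := by linarith
  refine hasExactly_inner_of_unique (p := (0, f)) hf ?_ (by simp) (by simp only; nlinarith)
  ext ⟨x, y⟩
  rw [mem_commonPoints, Set.mem_singleton_iff, Prod.mk.injEq]
  simp only
  constructor
  · rintro ⟨e1, e2⟩
    have e3 : (y - f) ^ 2 = 0 := by linear_combination e1 - e2 + hp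
    have e4 : y = f := by rw [sq_eq_zero_iff] at e3; linarith
    subst e4
    have : x ^ 2 = 0 := by linarith
    exact ⟨by simpa using this, rfl⟩
  · rintro ⟨rfl, rfl⟩
    constructor <;> linarith

lemma hasExactly_two_inner_of_centered (hf : f ≠ 0) (h3 : I3 circ (para g f c) = 0)
    (h4 : I4 circ (para g f c) = 0) (h5 : I5 circ (para g f c) < 0) :
    HasExactly circ (para g f c) 0 2 0 := by
  rw [I3_para hf] at h3
  rw [I4_para hf] at h4
  rw [I5_para hf] at h5
  have hg : g = 0 := by simpa using h3
  subst hg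
  obtain rfl : c = -1 - f ^ 2 := by linarith
  have hp : 0 < 1 - f ^ 2 := by linarith
  have hw := Real.sqrt_pos.mpr hp
  have hw2 := Real.sq_sqrt hp.le
  generalize √(1 - f ^ 2) = w at hw hw2
  have hr : HasRoots 0 f (-1 - f ^ 2) w w (-w) (-w) := by
    intro t
    constructor
    · rw [quartic]; linear_combination (2 * t ^ 2 - w ^ 2 - (1 - f ^ 2)) * hw2
    · rw [quarticDeriv]; linear_combination 4 * t * hw2
  exact hr.hasExactly_zero_two hf (by linarith)

lemma position_of_signCondition (hf : f ≠ 0) (i : Fin 9)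
    (h : SignCondition circ (para g f c) i) : Position circ (para g f c) i := by
  fin_cases i
  · obtain ⟨hd, hL⟩ := h
    obtain ⟨r₁, r₂, r₃, hr⟩ := exists_pencilRoots hf hd.le
    rw [L1_para hf, L2_para] at hL
    obtain ⟨h1, h2⟩ := hr.one_lt hf hL
    exact hr.separated hf h1 h2 (hr.lt_of_disc_pos hf hd).2
  · obtain ⟨hd, hL⟩ := h
    obtain ⟨r₁, r₂, r₃, hr⟩ := exists_pencilRoots hf hd.ge
    rw [L1_para hf, L2_para] at hL
    obtain ⟨h1, h2⟩ := hr.one_lt hf hL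
    exact hr.externallyTangent hf h2
      ((hr.eq_or_eq_of_disc_zero hf hd).resolve_left (by linarith))
  · rcases h with ⟨hd, hL1, hL2, h4⟩ | ⟨hd, hL1, hL2, h5, -, -⟩ | ⟨h3, h4, h5⟩
    · obtain ⟨r₁, r₂, r₃, hr⟩ := exists_pencilRoots hf hd.le
      rw [L1_para hf] at hL1
      rw [L2_para] at hL2
      obtain ⟨h12, h23⟩ := hr.lt_of_disc_pos hf hd
      exact hr.isInside hf h12 (hr.nonneg_of_pairs_neg hf (hr.pairs_neg hf h4)) h23
        (hr.lt_one hf hL1.le hL2.le)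
    · obtain ⟨r₁, r₂, r₃, hr⟩ := exists_pencilRoots hf hd.le
      rw [L1_para hf] at hL1
      rw [L2_para] at hL2
      obtain ⟨h12, h23⟩ := hr.lt_of_disc_pos hf hd
      exact hr.isInside hf h12 (hr.nonneg_of_sum_nonneg hf (hr.sum_nonneg hf h5)) h23
        (hr.lt_one hf hL1.le hL2.le)
    · exact isInside_of_centered hf h3 h4 h5
  · change disc circ (para g f c) < 0 at h
    rw [disc_para hf] at h
    exact hasExactly_two_of_disc_neg hf h
  · obtain ⟨hd, h4, h5⟩ := h
    obtain ⟨r₁, r₂, r₃, hr⟩ := exists_pencilRoots hf hd.le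
    obtain ⟨h12, h23⟩ := hr.lt_of_disc_pos hf hd
    exact hr.hasExactly_four hf h12
      (hr.nonpos_of_pairs_pos hf (hr.pairs_pos hf h4) (hr.sum_neg hf h5)).1 h23
  · obtain ⟨-, hd, hd', h4, h5⟩ := h
    obtain ⟨r₁, r₂, r₃, hr⟩ := exists_pencilRoots hf hd.ge
    refine hr.hasExactly_two_one hf
      (hr.nonpos_of_pairs_pos hf (hr.pairs_pos hf h4) (hr.sum_neg hf h5)).1 ?_
      (hr.eq_or_eq_of_disc_zero hf hd)
    rintro rfl
    obtain rfl : r₂ = r₁ := le_antisymm hr.le₂ hr.le₁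
    apply hd'
    rw [hr.disc'_eq hf]; ring
  · rcases h with ⟨hd, hL1, hL2, h3, h45⟩ | ⟨hd, hL1, hL2, h3, h5, h4⟩ | ⟨h3, h5, h4⟩
    · obtain ⟨r₁, r₂, r₃, hr⟩ := exists_pencilRoots hf hd.ge
      rw [L1_para hf] at hL1
      rw [L2_para] at hL2
      have hp := hr.prod_neg hf h3
      have h2 : 0 ≤ r₂ := by
        rcases h45 with h4 | h5
        · exact hr.nonneg_of_pairs_neg hf (hr.pairs_neg hf h4)
        · exact hr.nonneg_of_sum_nonneg hf (hr.sum_pos hf h5).le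
      have h2' : r₂ ≠ 0 := by rintro rfl; simp at hp
      have h23 : r₂ = r₃ := by
        refine (hr.eq_or_eq_of_disc_zero hf hd).resolve_left ?_
        rintro rfl
        have h0 := hr.le₂
        have h1 : 0 ≤ r₁ * r₁ * r₃ := mul_nonneg (mul_self_nonneg _) (h2.trans h0)
        linarith
      exact hr.hasExactly_inner hf (lt_of_le_of_ne h2 h2'.symm) h23 (hr.lt_one hf hL1.le hL2.le)
    · obtain ⟨r₁, r₂, r₃, hr⟩ := exists_pencilRoots hf hd.ge
      rw [L1_para hf] at hL1
      rw [L2_para] at hL2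
      have hp := hr.prod_zero hf h3
      have hs := hr.sum_pos hf h5
      have hk := hr.pairs_pos hf h4
      have h12 := hr.le₁
      have h23 := hr.le₂
      have h2 : 0 ≤ r₂ := hr.nonneg_of_sum_nonneg hf hs.le
      have h2' : r₂ ≠ 0 := by
        rintro rfl
        nlinarith
      have h2'' : 0 < r₂ := lt_of_le_of_ne h2 h2'.symm
      have h1 : r₁ = 0 := by
        have : r₂ * r₃ ≠ 0 := mul_ne_zero h2' (by linarith)
        rw [mul_assoc] at hp
        exact (mul_eq_zero.mp hp).resolve_right this
      exact hr.hasExactly_inner hf h2''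
        ((hr.eq_or_eq_of_disc_zero hf hd).resolve_left (by linarith)) (hr.lt_one hf hL1.le hL2.le)
    · exact hasExactly_inner_of_osculating hf h3 h5 h4
  · obtain ⟨h3, h4, h5⟩ := h
    exact hasExactly_two_inner_of_centered hf h3 h4 h5
  · obtain ⟨hd, hd', h3, h5⟩ := h
    obtain ⟨r₁, r₂, r₃, hr⟩ := exists_pencilRoots hf hd.ge
    rw [hr.disc'_eq hf] at hd'
    have hf2 : 0 < 2 * (f ^ 2) ^ 2 := by positivity
    have hz := (mul_eq_zero.mp hd').resolve_left hf2.ne'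
    have h12 : r₁ - r₂ = 0 := by
      nlinarith [sq_nonneg (r₁ - r₂), sq_nonneg (r₁ - r₃), sq_nonneg (r₂ - r₃)]
    have h13 : r₁ - r₃ = 0 := by
      nlinarith [sq_nonneg (r₁ - r₂), sq_nonneg (r₁ - r₃), sq_nonneg (r₂ - r₃)]
    obtain rfl : r₁ = r₂ := by linarith
    obtain rfl : r₁ = r₃ := by linarith
    have hs := hr.sum_neg hf h5
    exact hr.hasExactly_one_one hf (by linarith)

/-- The discriminant in terms of `I3`, `I4`, `I5`. -/
lemma disc_eq (hf : f ≠ 0) : disc circ (para g f c) =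
    -27 * (f ^ 2) ^ 2 * I3 circ (para g f c) ^ 2
      - 18 * f ^ 2 * I5 circ (para g f c) * I4 circ (para g f c) * I3 circ (para g f c)
      + I5 circ (para g f c) ^ 2 * I4 circ (para g f c) ^ 2
      - 4 * I5 circ (para g f c) ^ 3 * I3 circ (para g f c)
      + 4 * f ^ 2 * I4 circ (para g f c) ^ 3 := by
  rw [disc_para hf, I3_para hf, I4_para hf, I5_para hf]

lemma exists_signCondition (hf : f ≠ 0) : ∃ i, SignCondition circ (para g f c) i := by
  have hf2 : 0 < f ^ 2 := by positivity
  rcases lt_or_ge (disc circ (para g f c)) 0 with hd | hd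
  · exact ⟨3, hd⟩
  obtain ⟨r₁, r₂, r₃, hr⟩ := exists_pencilRoots hf hd
  by_cases hL : 0 < L1 circ (para g f c) ∨ 0 < L2 circ (para g f c)
  · rcases hd.lt_or_eq with hd | hd
    · exact ⟨0, hd, hL⟩
    · exact ⟨1, hd.symm, hL⟩
  -- with three real roots, nonpositive coefficients of the pencil determinant are negative
  have hL' : L1 circ (para g f c) < 0 ∧ L2 circ (para g f c) < 0 := by
    rw [L1_para hf, L2_para] at hL ⊢
    push Not at hL
    obtain ⟨hL1, hL2⟩ := hL
    have hneg := hr.lt_one hf hL1 hL2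
    have hu : 0 < 1 - r₁ := by linarith [hr.le₁, hr.le₂]
    have hv : 0 < 1 - r₂ := by linarith [hr.le₂]
    have hw : 0 < 1 - r₃ := by linarith
    have e1 : c - f ^ 2 - g ^ 2 = -(f ^ 2 * ((1 - r₁) + (1 - r₂) + (1 - r₃))) := by
      linear_combination hr.e₁
    have e2 : c - 1 =
        -(f ^ 2 * ((1 - r₁) * (1 - r₂) + (1 - r₁) * (1 - r₃) + (1 - r₂) * (1 - r₃))) := by
      linear_combination 2 * hr.e₁ + hr.e₂
    rw [e1, e2, neg_lt_zero, neg_lt_zero]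
    constructor <;> positivity
  obtain ⟨hL1, hL2⟩ := hL'
  have h3 : I3 circ (para g f c) ≤ 0 := by
    rw [I3_para hf]; nlinarith [sq_nonneg g]
  have hde := disc_eq (g := g) (c := c) hf
  have hde' : disc' circ (para g f c) =
      4 * I5 circ (para g f c) ^ 2 + 12 * f ^ 2 * I4 circ (para g f c) := by
    rw [disc'_para hf, I4_para hf, I5_para hf]
  have h245 : I2 circ (para g f c) = I4 circ (para g f c) + I5 circ (para g f c) - g ^ 2 := by
    rw [I2_para, I4_para hf, I5_para hf]; ring
  have hs6 : disc circ (para g f c) = 0 → disc' circ (para g f c) ≠ 0 →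
      I4 circ (para g f c) < 0 → I5 circ (para g f c) < 0 →
        ∃ i, SignCondition circ (para g f c) i :=
    fun h1 h2 h4 h5 => ⟨5, by nlinarith [sq_nonneg g], h1, h2, h4, h5⟩
  unfold SignCondition at hs6 ⊢
  generalize disc circ (para g f c) = d at *
  generalize disc' circ (para g f c) = d' at *
  generalize L1 circ (para g f c) = l1 at *
  generalize L2 circ (para g f c) = l2 at *
  generalize I2 circ (para g f c) = i2 at *
  generalize I3 circ (para g f c) = i3 at *
  generalize I4 circ (para g f c) = i4 at *
  generalize I5 circ (para g f c) = i5 at *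
  rcases hd.lt_or_eq with hd | hd
  · rcases lt_or_ge 0 i4 with h4 | h4
    · exact ⟨2, Or.inl ⟨hd, hL1, hL2, h4⟩⟩
    · rcases le_or_gt 0 i5 with h5 | h5
      · exact ⟨2, Or.inr (Or.inl ⟨hd, hL1, hL2, h5, h4, h3⟩)⟩
      · rcases h4.lt_or_eq with h4 | rfl
        · exact ⟨4, hd, h4, h5⟩
        · exfalso
          have : 0 ≤ i5 ^ 3 * i3 := mul_nonneg_of_nonpos_of_nonpos (by nlinarith [sq_nonneg i5]) h3
          have : 0 ≤ (f ^ 2) ^ 2 * i3 ^ 2 := by positivity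
          linarith
  · subst hd
    rcases h3.lt_or_eq with h3 | rfl
    · have hsq : 0 < (f ^ 2) ^ 2 * i3 ^ 2 := by have := h3.ne; positivity
      rcases lt_or_ge 0 i4 with h4 | h4
      · exact ⟨6, Or.inl ⟨rfl, hL1, hL2, h3, Or.inl h4⟩⟩
      rcases lt_or_ge 0 i5 with h5 | h5
      · exact ⟨6, Or.inl ⟨rfl, hL1, hL2, h3, Or.inr h5⟩⟩
      have h5' : 0 ≤ i5 ^ 3 * i3 := mul_nonneg_of_nonpos_of_nonpos
        (by nlinarith [sq_nonneg i5]) h3.le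
      have h4' : f ^ 2 * i4 ^ 3 ≤ 0 := mul_nonpos_of_nonneg_of_nonpos hf2.le
        (by nlinarith [sq_nonneg i4])
      have h4'' : i4 < 0 := by
        refine lt_of_le_of_ne h4 ?_
        rintro rfl
        linarith
      have h5'' : i5 < 0 := by
        refine lt_of_le_of_ne h5 ?_
        rintro rfl
        linarith
      by_cases hd' : d' = 0
      · exact ⟨8, rfl, hd', h3, h5''⟩
      · exact hs6 rfl hd' h4'' h5''
    · rcases eq_or_ne i4 0 with rfl | h4
      · rcases lt_trichotomy i5 0 with h5 | rfl | h5
        · exact ⟨7, rfl, rfl, h5⟩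
        · exact ⟨6, Or.inr (Or.inr ⟨rfl, rfl, rfl⟩)⟩
        · exact ⟨2, Or.inr (Or.inr ⟨rfl, rfl, h5⟩)⟩
      · have e : i4 ^ 2 * (i5 ^ 2 + 4 * f ^ 2 * i4) = 0 := by linear_combination -hde
        have e' := (mul_eq_zero.mp e).resolve_left (pow_ne_zero 2 h4)
        have h4' : i4 < 0 := by
          refine lt_of_le_of_ne ?_ h4
          by_contra hn
          push Not at hn
          have : 0 < f ^ 2 * i4 := by positivity
          nlinarith [sq_nonneg i5]
        have h5 : i5 ≠ 0 := by
          rintro rfl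
          have : f ^ 2 * i4 < 0 := mul_neg_of_pos_of_neg hf2 h4'
          linarith
        rcases lt_or_gt_of_ne h5 with h5' | h5'
        · refine hs6 rfl ?_ h4' h5'
          have : d' = i5 ^ 2 := by linear_combination hde' + 3 * e'
          rw [this]; exact pow_ne_zero 2 h5
        · exact ⟨6, Or.inr (Or.inl ⟨rfl, hL1, hL2, rfl, h5', h4'⟩)⟩

lemma position_iff_signCondition (hf : f ≠ 0) (i : Fin 9) :
    Position circ (para g f c) i ↔ SignCondition circ (para g f c) i :=
  iff_of_exhaustive_of_exclusive (position_of_signCondition hf) (exists_signCondition hf)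
    position_exclusive i

end ConicPosition

/-! ### Invariance under affine transformations and rescaling -/

namespace ConicPosition

open scoped Matrix

lemma trace_adjugate_congr {n : Type*} [Fintype n] [DecidableEq n] (R A B : Matrix n n ℝ) :
    ((Rᵀ * A * R).adjugate * (Rᵀ * B * R)).trace = R.det ^ 2 * (A.adjugate * B).trace := by
  have h1 : (Rᵀ * A * R).adjugate * (Rᵀ * B * R) =
      R.adjugate * (A.adjugate * (Rᵀ.adjugate * Rᵀ) * B * R) := by
    rw [Matrix.adjugate_mul_distrib, Matrix.adjugate_mul_distrib]
    simp only [Matrix.mul_assoc]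
  rw [h1, Matrix.trace_mul_comm, Matrix.mul_assoc, Matrix.mul_adjugate, Matrix.adjugate_mul,
    Matrix.det_transpose]
  simp only [Matrix.mul_smul, Matrix.smul_mul, Matrix.mul_one, Matrix.trace_smul, smul_eq_mul]
  ring

/-- `R` is the matrix of an affine automorphism of the plane. -/
structure IsAffine (R : Matrix (Fin 3) (Fin 3) ℝ) : Prop where
  row₀ : R 2 0 = 0
  row₁ : R 2 1 = 0
  row₂ : R 2 2 = 1
  det_ne_zero : R.det ≠ 0

/-- The affine map with matrix `R`. -/
def affineMap (R : Matrix (Fin 3) (Fin 3) ℝ) (p : ℝ × ℝ) : ℝ × ℝ :=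
  ((R *ᵥ hom p) 0, (R *ᵥ hom p) 1)

namespace IsAffine

variable {R : Matrix (Fin 3) (Fin 3) ℝ}

lemma mulVec_two (hR : IsAffine R) (w : Fin 3 → ℝ) : (R *ᵥ w) 2 = w 2 := by
  simp [Matrix.mulVec, dotProduct, Fin.sum_univ_three, hR.row₀, hR.row₁, hR.row₂]

lemma hom_affineMap (hR : IsAffine R) (p : ℝ × ℝ) : hom (affineMap R p) = R *ᵥ hom p := by
  ext i
  fin_cases i
  · rfl
  · rfl
  · simp [hR.mulVec_two, hom]

lemma bijective (hR : IsAffine R) : Function.Bijective (affineMap R) := by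
  constructor
  · intro p q h
    have h1 : R *ᵥ hom p = R *ᵥ hom q := by rw [← hR.hom_affineMap, ← hR.hom_affineMap, h]
    have h2 := Matrix.mulVec_injective_of_isUnit
      ((Matrix.isUnit_iff_isUnit_det R).mpr hR.det_ne_zero.isUnit) h1
    exact Prod.ext (congrFun h2 0) (congrFun h2 1)
  · intro q
    obtain ⟨w, hw⟩ : ∃ w, R *ᵥ w = hom q :=
      ⟨R⁻¹ *ᵥ hom q, by rw [Matrix.mulVec_mulVec, Matrix.mul_nonsing_inv _ hR.det_ne_zero.isUnit,
        Matrix.one_mulVec]⟩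
    have hw2 : w 2 = 1 := by rw [← hR.mulVec_two w, hw]; rfl
    have hw' : hom (w 0, w 1) = w := by
      ext i; fin_cases i
      · rfl
      · rfl
      · exact hw2.symm
    refine ⟨(w 0, w 1), ?_⟩
    rw [affineMap, hw', hw]
    rfl

lemma quadPart_congr (hR : IsAffine R) (A : Matrix (Fin 3) (Fin 3) ℝ) :
    quadPart (Rᵀ * A * R) = (quadPart R)ᵀ * quadPart A * quadPart R := by
  ext i j
  fin_cases i <;> fin_cases j <;>
    simp [quadPart, Matrix.mul_apply, Fin.sum_univ_three, Fin.sum_univ_two, hR.row₀, hR.row₁]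

lemma det_quadPart (hR : IsAffine R) : (quadPart R).det = R.det := by
  rw [Matrix.det_fin_three, Matrix.det_fin_two, hR.row₀, hR.row₁, hR.row₂]
  simp [quadPart]

end IsAffine

lemma quadPart_smul (k : ℝ) (A : Matrix (Fin 3) (Fin 3) ℝ) : quadPart (k • A) = k • quadPart A := by
  ext i j
  fin_cases i <;> fin_cases j <;> simp [quadPart]

section Transfer

variable {R M N M' N' : Matrix (Fin 3) (Fin 3) ℝ} {k m : ℝ}

/-- The hypothesis `Rᵀ M R = k M'` with `k > 0` says that the affine map `R` carries the conic `M'`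
to the conic `M`, and interiors to interiors. -/
lemma polar_transfer (hR : IsAffine R) (h : Rᵀ * M * R = k • M') (v p : ℝ × ℝ) :
    hom (affineMap R v) ⬝ᵥ (M *ᵥ hom (affineMap R p)) = k * (hom v ⬝ᵥ (M' *ᵥ hom p)) := by
  have h1 : hom v ⬝ᵥ ((Rᵀ * M * R) *ᵥ hom p) = k * (hom v ⬝ᵥ (M' *ᵥ hom p)) := by
    rw [h, Matrix.smul_mulVec, dotProduct_smul, smul_eq_mul]
  rw [← h1, hR.hom_affineMap, hR.hom_affineMap, ← Matrix.mulVec_mulVec, ← Matrix.mulVec_mulVec,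
    Matrix.mulVec_transpose, dotProduct_comm (hom v), ← Matrix.dotProduct_mulVec, dotProduct_comm]

lemma line_transfer (hR : IsAffine R) (v : ℝ × ℝ) (l : Fin 3 → ℝ) :
    hom v ⬝ᵥ (Rᵀ *ᵥ l) = hom (affineMap R v) ⬝ᵥ l := by
  rw [hR.hom_affineMap, Matrix.mulVec_transpose, dotProduct_comm, ← Matrix.dotProduct_mulVec,
    dotProduct_comm]

lemma mem_curve_transfer (hR : IsAffine R) (hk : 0 < k) (h : Rᵀ * M * R = k • M') (p : ℝ × ℝ) :
    affineMap R p ∈ curve M ↔ p ∈ curve M' := by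
  simp only [curve, Set.mem_ofPred_eq, conicValue, polar_transfer hR h, mul_eq_zero, hk.ne',
    false_or]

lemma mem_inside_transfer (hR : IsAffine R) (hk : 0 < k) (h : Rᵀ * M * R = k • M') (p : ℝ × ℝ) :
    affineMap R p ∈ inside M ↔ p ∈ inside M' := by
  simp only [inside, Set.mem_ofPred_eq, conicValue, polar_transfer hR h]
  exact smul_neg_iff_of_pos_left hk

lemma tangentLine_transfer (hR : IsAffine R) (hk : 0 < k) (h : Rᵀ * M * R = k • M') (p : ℝ × ℝ) :
    affineMap R ⁻¹' tangentLine M (affineMap R p) = tangentLine M' p := by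
  ext v
  simp only [tangentLine, Set.mem_preimage, Set.mem_ofPred_eq, polar_transfer hR h, mul_eq_zero,
    hk.ne', false_or]

lemma lineOf_transfer (hR : IsAffine R) (l : Fin 3 → ℝ) :
    affineMap R ⁻¹' lineOf l = lineOf (Rᵀ *ᵥ l) := by
  ext v
  simp only [lineOf, Set.mem_preimage, Set.mem_ofPred_eq, line_transfer hR]

lemma transpose_mulVec_surjective (hR : IsAffine R) :
    Function.Surjective (fun l : Fin 3 → ℝ => Rᵀ *ᵥ l) := by
  intro l
  refine ⟨Rᵀ⁻¹ *ᵥ l, ?_⟩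
  simp only [Matrix.mulVec_mulVec]
  rw [Matrix.mul_nonsing_inv _ (by rw [Matrix.det_transpose]; exact hR.det_ne_zero.isUnit),
    Matrix.one_mulVec]

lemma mem_commonPoints_transfer (hR : IsAffine R) (hk : 0 < k) (hm : 0 < m)
    (h : Rᵀ * M * R = k • M') (h' : Rᵀ * N * R = m • N') (p : ℝ × ℝ) :
    affineMap R p ∈ commonPoints M N ↔ p ∈ commonPoints M' N' := by
  simp only [commonPoints, Set.mem_inter_iff, mem_curve_transfer hR hk h,
    mem_curve_transfer hR hm h']

lemma tangentLine_eq_transfer (hR : IsAffine R) (hk : 0 < k) (hm : 0 < m)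
    (h : Rᵀ * M * R = k • M') (h' : Rᵀ * N * R = m • N') (p : ℝ × ℝ) :
    tangentLine M (affineMap R p) = tangentLine N (affineMap R p) ↔
      tangentLine M' p = tangentLine N' p := by
  rw [← tangentLine_transfer hR hk h, ← tangentLine_transfer hR hm h',
    hR.bijective.surjective.preimage_injective.eq_iff]

lemma crossingPoints_transfer (hR : IsAffine R) (hk : 0 < k) (hm : 0 < m)
    (h : Rᵀ * M * R = k • M') (h' : Rᵀ * N * R = m • N') :
    affineMap R ⁻¹' crossingPoints M N = crossingPoints M' N' := by
  ext p
  simp only [crossingPoints, Set.mem_preimage, Set.mem_ofPred_eq,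
    mem_commonPoints_transfer hR hk hm h h', ne_eq, tangentLine_eq_transfer hR hk hm h h']

lemma innerTangentPoints_transfer (hR : IsAffine R) (hk : 0 < k) (hm : 0 < m)
    (h : Rᵀ * M * R = k • M') (h' : Rᵀ * N * R = m • N') :
    affineMap R ⁻¹' innerTangentPoints M N = innerTangentPoints M' N' := by
  ext p
  simp only [innerTangentPoints, Set.mem_preimage, Set.mem_ofPred_eq,
    mem_commonPoints_transfer hR hk hm h h', tangentLine_eq_transfer hR hk hm h h']
  refine and_congr_right fun _ => and_congr_right fun _ => ?_
  refine (exists_congr fun l => ?_).trans (transpose_mulVec_surjective hR).exists.symm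
  rw [← lineOf_transfer hR, ← tangentLine_transfer hR hk h,
    hR.bijective.surjective.preimage_injective.eq_iff]
  refine and_congr_right fun _ => and_congr ?_ ?_ <;> rw [hR.bijective.surjective.forall]
  · simp only [mem_curve_transfer hR hk h, line_transfer hR]
  · simp only [mem_curve_transfer hR hm h', line_transfer hR]

lemma outerTangentPoints_transfer (hR : IsAffine R) (hk : 0 < k) (hm : 0 < m)
    (h : Rᵀ * M * R = k • M') (h' : Rᵀ * N * R = m • N') :
    affineMap R ⁻¹' outerTangentPoints M N = outerTangentPoints M' N' := by
  ext p
  simp only [outerTangentPoints, Set.mem_preimage, Set.mem_ofPred_eq,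
    mem_commonPoints_transfer hR hk hm h h', tangentLine_eq_transfer hR hk hm h h']
  refine and_congr_right fun _ => and_congr_right fun _ => ?_
  refine (exists_congr fun l => ?_).trans (transpose_mulVec_surjective hR).exists.symm
  rw [← lineOf_transfer hR, ← tangentLine_transfer hR hk h,
    hR.bijective.surjective.preimage_injective.eq_iff]
  refine and_congr_right fun _ => and_congr ?_ ?_ <;> rw [hR.bijective.surjective.forall]
  · simp only [mem_curve_transfer hR hk h, line_transfer hR]
  · simp only [mem_curve_transfer hR hm h', line_transfer hR]

lemma hasExactly_transfer (hR : IsAffine R) (hk : 0 < k) (hm : 0 < m)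
    (h : Rᵀ * M * R = k • M') (h' : Rᵀ * N * R = m • N') (a b d : ℕ) :
    HasExactly M N a b d ↔ HasExactly M' N' a b d := by
  have h0 : affineMap R ⁻¹' commonPoints M N = commonPoints M' N' :=
    Set.ext (mem_commonPoints_transfer hR hk hm h h')
  simp only [HasExactly, ← crossingPoints_transfer hR hk hm h h',
    ← innerTangentPoints_transfer hR hk hm h h', ← outerTangentPoints_transfer hR hk hm h h', ← h0,
    Set.encard_preimage_of_bijective hR.bijective]

lemma separated_transfer (hR : IsAffine R) (hk : 0 < k) (hm : 0 < m)
    (h : Rᵀ * M * R = k • M') (h' : Rᵀ * N * R = m • N') : Separated M N ↔ Separated M' N' := by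
  simp only [Separated, Set.disjoint_left]
  rw [hR.bijective.surjective.forall]
  simp only [Set.mem_union, mem_curve_transfer hR hk h, mem_curve_transfer hR hm h',
    mem_inside_transfer hR hk h, mem_inside_transfer hR hm h']

lemma isInside_transfer (hR : IsAffine R) (hk : 0 < k) (hm : 0 < m)
    (h : Rᵀ * M * R = k • M') (h' : Rᵀ * N * R = m • N') : IsInside M N ↔ IsInside M' N' := by
  simp only [IsInside, Set.subset_def]
  rw [hR.bijective.surjective.forall]
  simp only [Set.mem_union, mem_curve_transfer hR hk h,
    mem_inside_transfer hR hk h, mem_inside_transfer hR hm h']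

lemma position_transfer (hR : IsAffine R) (hk : 0 < k) (hm : 0 < m)
    (h : Rᵀ * M * R = k • M') (h' : Rᵀ * N * R = m • N') (i : Fin 9) :
    Position M N i ↔ Position M' N' i := by
  fin_cases i
  · exact separated_transfer hR hk hm h h'
  · exact hasExactly_transfer hR hk hm h h' _ _ _
  · exact isInside_transfer hR hk hm h h'
  all_goals exact hasExactly_transfer hR hk hm h h' _ _ _

lemma det_transfer (h : Rᵀ * M * R = k • M') : R.det ^ 2 * M.det = k ^ 3 * M'.det := by
  have := congrArg Matrix.det h
  rw [Matrix.det_mul, Matrix.det_mul, Matrix.det_transpose, Matrix.det_smul, Fintype.card_fin]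
    at this
  linear_combination this

lemma det_quadPart_transfer (hR : IsAffine R) (h : Rᵀ * M * R = k • M') :
    R.det ^ 2 * (quadPart M).det = k ^ 2 * (quadPart M').det := by
  have := congrArg (fun A => (quadPart A).det) h
  simp only [hR.quadPart_congr, quadPart_smul, Matrix.det_mul, Matrix.det_transpose,
    Matrix.det_smul, Fintype.card_fin, hR.det_quadPart] at this
  linear_combination this

lemma trace_adjugate_transfer (h : Rᵀ * M * R = k • M') (h' : Rᵀ * N * R = m • N') :
    R.det ^ 2 * (N.adjugate * M).trace = m ^ 2 * k * (N'.adjugate * M').trace := by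
  rw [← trace_adjugate_congr, h, h', Matrix.adjugate_smul, Fintype.card_fin, Matrix.smul_mul,
    Matrix.mul_smul, Matrix.trace_smul, Matrix.trace_smul, smul_eq_mul, smul_eq_mul]
  ring

lemma trace_adjugate_quadPart_transfer (hR : IsAffine R) (h : Rᵀ * M * R = k • M')
    (h' : Rᵀ * N * R = m • N') : R.det ^ 2 * ((quadPart M).adjugate * quadPart N).trace =
      k * m * ((quadPart M').adjugate * quadPart N').trace := by
  rw [← hR.det_quadPart, ← trace_adjugate_congr, ← hR.quadPart_congr, ← hR.quadPart_congr, h,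
    h', quadPart_smul, quadPart_smul, Matrix.adjugate_smul, Fintype.card_fin, Matrix.smul_mul,
    Matrix.mul_smul, Matrix.trace_smul, Matrix.trace_smul, smul_eq_mul, smul_eq_mul]
  ring

/-- All invariants are multiplied by positive factors. -/
lemma signCondition_transfer (hR : IsAffine R) (hk : 0 < k) (hm : 0 < m)
    (h : Rᵀ * M * R = k • M') (h' : Rᵀ * N * R = m • N') (hM : M.det ≠ 0) (hN : N.det ≠ 0)
    (hQ : (quadPart M).det ≠ 0) : SignCondition M N = SignCondition M' N' := by
  have hd : R.det ^ 2 ≠ 0 := pow_ne_zero 2 hR.det_ne_zero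
  obtain ⟨s, hs, hs1⟩ : ∃ s > 0, s * R.det ^ 2 = 1 :=
    ⟨(R.det ^ 2)⁻¹, by have := hR.det_ne_zero; positivity, inv_mul_cancel₀ hd⟩
  have d1 := det_transfer h
  have d2 := det_transfer h'
  have d3 := det_quadPart_transfer hR h
  have hM' : M'.det ≠ 0 := by
    intro h0; rw [h0, mul_zero] at d1; exact mul_ne_zero hd hM d1
  have hN' : N'.det ≠ 0 := by
    intro h0; rw [h0, mul_zero] at d2; exact mul_ne_zero hd hN d2
  have hQ' : (quadPart M').det ≠ 0 := by
    intro h0; rw [h0, mul_zero] at d3; exact mul_ne_zero hd hQ d3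
  have e0 : L0 N = s * m ^ 3 * L0 N' := by
    rw [L0, L0]; linear_combination s * d2 - N.det * hs1
  have e3 : L3 M = s * k ^ 3 * L3 M' := by
    rw [L3, L3]; linear_combination s * d1 - M.det * hs1
  have e1 : L1 M N = s * m ^ 2 * k * L1 M' N' := by
    rw [L1_eq hN, L1_eq hN']
    linear_combination s * trace_adjugate_transfer h h' - (N.adjugate * M).trace * hs1
  have e2 : L2 M N = s * k ^ 2 * m * L2 M' N' := by
    rw [L2_eq hM, L2_eq hM']
    linear_combination s * trace_adjugate_transfer h' h - (M.adjugate * N).trace * hs1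
  have t1 : T1 M = s * k ^ 2 * T1 M' := by
    rw [T1, T1]; linear_combination s * d3 - (quadPart M).det * hs1
  have t : T M N = s * k * m * T M' N' := by
    rw [T_eq hQ, T_eq hQ']
    linear_combination s * trace_adjugate_quadPart_transfer hR h h' -
      ((quadPart M).adjugate * quadPart N).trace * hs1
  have hdisc : disc M N = (s ^ 4 * m ^ 6 * k ^ 6) * disc M' N' := by
    rw [disc, disc, e0, e1, e2, e3]; ring
  have hdisc' : disc' M N = (s ^ 2 * m ^ 4 * k ^ 2) * disc' M' N' := by
    rw [disc', disc', e0, e1, e2]; ring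
  have i2 : I2 M N = (s ^ 4 * m ^ 3 * k ^ 6) * I2 M' N' := by
    rw [I2, I2, e0, e3, t1, t]; ring
  have i3 : I3 M N = (s ^ 4 * m ^ 3 * k ^ 6) * I3 M' N' := by
    rw [I3, I3, e0, e1, e2, e3, t1, t]; ring
  have i4 : I4 M N = (s ^ 3 * m ^ 3 * k ^ 4) * I4 M' N' := by
    rw [I4, I4, e0, e1, e2, t1, t]; ring
  have i5 : I5 M N = (s ^ 2 * m ^ 3 * k ^ 2) * I5 M' N' := by
    rw [I5, I5, e0, e1, t1, t]; ring
  have key : ∀ {κ x y : ℝ}, 0 < κ → x = κ * y →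
      (0 < x ↔ 0 < y) ∧ (x < 0 ↔ y < 0) ∧ (x = 0 ↔ y = 0) ∧ (0 ≤ x ↔ 0 ≤ y) ∧ (x ≤ 0 ↔ y ≤ 0) := by
    rintro κ x y hκ rfl
    have a := smul_pos_iff_of_pos_left (b := y) hκ
    have b := smul_neg_iff_of_pos_left (b := y) hκ
    rw [smul_eq_mul] at a b
    exact ⟨a, b, by simp [hκ.ne'], by rw [← not_lt, b, not_lt], by rw [← not_lt, a, not_lt]⟩
  obtain ⟨a1, a2, a3, -, -⟩ := key (by positivity) hdisc
  obtain ⟨-, -, b3, -, -⟩ := key (by positivity) hdisc'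
  obtain ⟨c1, c2, -, -, -⟩ := key (by positivity) e1
  obtain ⟨f1, f2, -, -, -⟩ := key (by positivity) e2
  obtain ⟨-, -, -, -, g5⟩ := key (by positivity) i2
  obtain ⟨-, j2, j3, -, j5⟩ := key (by positivity) i3
  obtain ⟨k1, k2, k3, -, k5⟩ := key (by positivity) i4
  obtain ⟨l1, l2, l3, l4, -⟩ := key (by positivity) i5
  simp only [SignCondition, a1, a2, a3, ne_eq, b3, c1, c2, f1, f2, g5, j2, j3, j5, k1, k2, k3, k5,
    l1, l2, l3, l4]

end Transfer

/-! ### Reduction to a circle and a parabola with vertical axis -/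

/-- The new origin is the centre of the ellipse; the new axes are conjugate directions of the
ellipse, the second being the direction of the axis of the parabola. -/
lemma exists_normal_form {M N : Matrix (Fin 3) (Fin 3) ℝ} (hM : IsEllipse M) (hN : IsParabola N)
    (hL3 : M.det < 0) (hL0 : N.det < 0) :
    ∃ (R : Matrix (Fin 3) (Fin 3) ℝ) (k m g f c : ℝ), IsAffine R ∧ 0 < k ∧ 0 < m ∧ f ≠ 0 ∧
      Rᵀ * M * R = k • circ ∧ Rᵀ * N * R = m • para g f c := by
  obtain ⟨hMs, hD, htr⟩ := hM
  obtain ⟨hNs, hN0, -⟩ := hN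
  obtain ⟨κ, hκ, hκ0⟩ := Matrix.exists_mulVec_eq_zero_iff.mpr hN0
  have n0 := congrFun hκ0 0
  have n1 := congrFun hκ0 1
  simp only [quadPart, Matrix.mulVec, dotProduct, Fin.sum_univ_two, Matrix.of_apply,
    Matrix.cons_val, Pi.zero_apply] at n0 n1
  rw [quadPart, Matrix.det_fin_two_of] at hD
  have hdet := hL3
  rw [Matrix.det_fin_three] at hdet
  have s01 := hMs.apply 0 1
  have s02 := hMs.apply 0 2
  have s12 := hMs.apply 1 2
  have hNs01 := hNs.apply 0 1
  have hNs02 := hNs.apply 0 2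
  have hNs12 := hNs.apply 1 2
  rw [s01] at hD
  rw [s01, s02, s12] at hdet
  rw [hNs01] at n1
  have htr' : 0 < M 0 0 + M 1 1 := by
    by_contra hn
    push Not at hn
    have := mul_nonneg_of_nonpos_of_nonpos hn hL3.le
    linarith
  obtain ⟨a, ha⟩ : ∃ a, a = M 0 0 := ⟨_, rfl⟩
  obtain ⟨b, hb⟩ : ∃ b, b = M 0 1 := ⟨_, rfl⟩
  obtain ⟨c, hc⟩ : ∃ c, c = M 1 1 := ⟨_, rfl⟩
  obtain ⟨d, hd⟩ : ∃ d, d = M 0 2 := ⟨_, rfl⟩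
  obtain ⟨e, he⟩ : ∃ e, e = M 1 2 := ⟨_, rfl⟩
  obtain ⟨q, hq⟩ : ∃ q, q = M 2 2 := ⟨_, rfl⟩
  obtain ⟨x, hx⟩ : ∃ x, x = κ 0 := ⟨_, rfl⟩
  obtain ⟨y, hy⟩ : ∃ y, y = κ 1 := ⟨_, rfl⟩
  have hxy : x ≠ 0 ∨ y ≠ 0 := by
    by_contra hn
    push Not at hn
    apply hκ
    ext i; fin_cases i
    · exact hx.symm.trans hn.1
    · exact hy.symm.trans hn.2
  simp only [← ha, ← hb, ← hc, ← hd, ← he, ← hq, ← hx,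
    ← hy] at hD hdet htr htr' s01 s02 s12 n0 n1
  have ha0 : 0 < a := by
    by_contra hn
    push Not at hn
    have : 0 < c := by linarith
    nlinarith [mul_nonneg (neg_nonneg.mpr hn) this.le, sq_nonneg b]
  obtain ⟨D, hDd⟩ : ∃ D, D = a * c - b * b := ⟨_, rfl⟩
  obtain ⟨W, hW⟩ : ∃ W, W = a * x ^ 2 + 2 * b * x * y + c * y ^ 2 := ⟨_, rfl⟩
  obtain ⟨δ, hδ⟩ : ∃ δ, δ = a * c * q - a * e * e - b * b * q + b * e * d + d * b * e - d * c * d :=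
    ⟨_, rfl⟩
  rw [← hDd] at hD
  have hδ0 : δ < 0 := by rw [hδ]; linarith
  have hW0 : 0 < W := by
    have e1 : a * W = (a * x + b * y) ^ 2 + D * y ^ 2 := by rw [hW, hDd]; ring
    have e2 : 0 < (a * x + b * y) ^ 2 + D * y ^ 2 := by
      rcases eq_or_ne y 0 with rfl | hy0
      · have hx0 : x ≠ 0 := by simpa using hxy
        simp only [mul_zero, add_zero]
        positivity
      · positivity
    rw [← e1] at e2
    exact pos_of_mul_pos_right e2 ha0.le
  have hk : 0 < -δ / D := div_pos (by linarith) hD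
  have hr2 : 0 < -δ / D / W := div_pos hk hW0
  have hr1 : 0 < -δ / D / (D * W) := div_pos hk (mul_pos hD hW0)
  obtain ⟨ρ, hρ, hρ2⟩ : ∃ ρ > 0, ρ ^ 2 = -δ / D / (D * W) :=
    ⟨_, Real.sqrt_pos.mpr hr1, Real.sq_sqrt hr1.le⟩
  obtain ⟨σ, hσ, hσ2⟩ : ∃ σ > 0, σ ^ 2 = -δ / D / W :=
    ⟨_, Real.sqrt_pos.mpr hr2, Real.sq_sqrt hr2.le⟩
  have hρ3 : ρ ^ 2 * (D * W) = -δ / D := by rw [hρ2]; field_simp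
  have hσ3 : σ ^ 2 * W = -δ / D := by rw [hσ2]; field_simp
  obtain ⟨z, hz⟩ : ∃ z, z = (b * e - c * d) / D := ⟨_, rfl⟩
  obtain ⟨w, hw⟩ : ∃ w, w = (b * d - a * e) / D := ⟨_, rfl⟩
  have z1 : a * z + b * w + d = 0 := by rw [hz, hw]; field_simp; rw [hDd]; ring
  have z2 : b * z + c * w + e = 0 := by rw [hz, hw]; field_simp; rw [hDd]; ring
  have z3 : d * z + e * w + q = δ / D := by rw [hz, hw]; field_simp; rw [hDd, hδ]; ring
  let R : Matrix (Fin 3) (Fin 3) ℝ :=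
    !![-ρ * (b * x + c * y), σ * x, z; ρ * (a * x + b * y), σ * y, w; 0, 0, 1]
  have hRdet : R.det = -(ρ * σ * W) := by
    simp [R, Matrix.det_fin_three]; rw [hW]; ring
  have hR : IsAffine R := ⟨rfl, rfl, rfl, by rw [hRdet]; simp [hρ.ne', hσ.ne', hW0.ne']⟩
  have hRM : Rᵀ * M * R = (-δ / D) • circ := by
    have m00 : ρ ^ 2 * (a * (b * x + c * y) ^ 2 - 2 * b * (b * x + c * y) * (a * x + b * y) +
        c * (a * x + b * y) ^ 2) = -δ / D := by rw [← hρ3, hDd, hW]; ring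
    have m11 : σ ^ 2 * (a * x ^ 2 + 2 * b * x * y + c * y ^ 2) = -δ / D := by rw [← hσ3, hW]
    have m22 : (a * z + b * w + d) * z + (b * z + c * w + e) * w + (d * z + e * w + q) =
        -(-δ / D) := by rw [z1, z2, z3]; ring
    ext i j
    fin_cases i <;> fin_cases j <;>
      simp [R, circ, Matrix.mul_apply, Fin.sum_univ_three, s01, s02, s12, ← ha, ← hb, ← hc, ← hd,
        ← he, ← hq]
    · linear_combination m00
    · ring
    · linear_combination (-ρ * (b * x + c * y)) * z1 + ρ * (a * x + b * y) * z2
    · ring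
    · linear_combination m11
    · linear_combination σ * x * z1 + σ * y * z2
    · linear_combination (-ρ * (b * x + c * y)) * z1 + ρ * (a * x + b * y) * z2
    · linear_combination σ * x * z1 + σ * y * z2
    · linear_combination m22
  have hBs : (Rᵀ * N * R).IsSymm := by
    rw [Matrix.IsSymm, Matrix.transpose_mul, Matrix.transpose_mul, Matrix.transpose_transpose,
      hNs.eq, Matrix.mul_assoc]
  have hBdet : (Rᵀ * N * R).det < 0 := by
    rw [Matrix.det_mul, Matrix.det_mul, Matrix.det_transpose]
    have hd2 : 0 < R.det ^ 2 := by have := hR.det_ne_zero; positivity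
    have e1 : R.det * N.det * R.det = R.det ^ 2 * N.det := by ring
    rw [e1]
    exact mul_neg_of_pos_of_neg hd2 hL0
  -- the second column of `R` spans the kernel of the quadratic part of `N`
  have hB01 : (Rᵀ * N * R) 0 1 = 0 := by
    simp [R, Matrix.mul_apply, Fin.sum_univ_three, hNs01]
    linear_combination (-ρ * (b * x + c * y) * σ) * n0 + ρ * (a * x + b * y) * σ * n1
  have hB11 : (Rᵀ * N * R) 1 1 = 0 := by
    simp [R, Matrix.mul_apply, Fin.sum_univ_three, hNs01]
    linear_combination σ ^ 2 * x * n0 + σ ^ 2 * y * n1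
  obtain ⟨B, hB⟩ : ∃ B, B = Rᵀ * N * R := ⟨_, rfl⟩
  rw [← hB] at hBs hBdet hB01 hB11
  have b10 := hBs.apply 0 1
  have b20 := hBs.apply 0 2
  have b21 := hBs.apply 1 2
  rw [hB01] at b10
  rw [Matrix.det_fin_three, b10, b20, b21, hB01, hB11] at hBdet
  have hBd : 0 < B 0 0 * B 1 2 ^ 2 := by linarith
  have hB00 : 0 < B 0 0 := pos_of_mul_pos_left hBd (sq_nonneg _)
  have hB12 : B 1 2 ≠ 0 := by intro h0; rw [h0] at hBd; simp at hBd
  refine ⟨R, -δ / D, B 0 0, B 0 2 / B 0 0, B 1 2 / B 0 0, B 2 2 / B 0 0, hR, hk, hB00,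
    div_ne_zero hB12 hB00.ne', hRM, ?_⟩
  rw [← hB]
  ext i j
  fin_cases i <;> fin_cases j <;> simp [para, b10, b20, b21, hB01, hB11] <;> field_simp

end ConicPosition

theorem mainTheorem2 (M N : Matrix (Fin 3) (Fin 3) ℝ)
    (hM : ConicPosition.IsEllipse M) (hN : ConicPosition.IsParabola N)
    (hL3 : ConicPosition.L3 M < 0) (hL0 : ConicPosition.L0 N < 0) :
    (ConicPosition.Separated M N ↔
      0 < ConicPosition.disc M N ∧ (0 < ConicPosition.L1 M N ∨ 0 < ConicPosition.L2 M N)) ∧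
    (ConicPosition.ExternallyTangent M N ↔
      ConicPosition.disc M N = 0 ∧ (0 < ConicPosition.L1 M N ∨ 0 < ConicPosition.L2 M N)) ∧
    (ConicPosition.IsInside M N ↔
      (0 < ConicPosition.disc M N ∧ ConicPosition.L1 M N < 0 ∧ ConicPosition.L2 M N < 0 ∧
        0 < ConicPosition.I4 M N) ∨
      (0 < ConicPosition.disc M N ∧ ConicPosition.L1 M N < 0 ∧ ConicPosition.L2 M N < 0 ∧
        0 ≤ ConicPosition.I5 M N ∧ ConicPosition.I4 M N ≤ 0 ∧ ConicPosition.I3 M N ≤ 0) ∨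
      (ConicPosition.I3 M N = 0 ∧ ConicPosition.I4 M N = 0 ∧ 0 < ConicPosition.I5 M N)) ∧
    (ConicPosition.HasExactly M N 2 0 0 ↔ ConicPosition.disc M N < 0) ∧
    (ConicPosition.HasExactly M N 4 0 0 ↔
      0 < ConicPosition.disc M N ∧ ConicPosition.I4 M N < 0 ∧ ConicPosition.I5 M N < 0) ∧
    (ConicPosition.HasExactly M N 2 1 0 ↔
      ConicPosition.I2 M N ≤ 0 ∧ ConicPosition.disc M N = 0 ∧ ConicPosition.disc' M N ≠ 0 ∧
        ConicPosition.I4 M N < 0 ∧ ConicPosition.I5 M N < 0) ∧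
    (ConicPosition.HasExactly M N 0 1 0 ↔
      (ConicPosition.disc M N = 0 ∧ ConicPosition.L1 M N < 0 ∧ ConicPosition.L2 M N < 0 ∧
        ConicPosition.I3 M N < 0 ∧ (0 < ConicPosition.I4 M N ∨ 0 < ConicPosition.I5 M N)) ∨
      (ConicPosition.disc M N = 0 ∧ ConicPosition.L1 M N < 0 ∧ ConicPosition.L2 M N < 0 ∧
        ConicPosition.I3 M N = 0 ∧ 0 < ConicPosition.I5 M N ∧ ConicPosition.I4 M N < 0) ∨
      (ConicPosition.I3 M N = 0 ∧ ConicPosition.I5 M N = 0 ∧ ConicPosition.I4 M N = 0)) ∧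
    (ConicPosition.HasExactly M N 0 2 0 ↔
      ConicPosition.I3 M N = 0 ∧ ConicPosition.I4 M N = 0 ∧ ConicPosition.I5 M N < 0) ∧
    (ConicPosition.HasExactly M N 1 1 0 ↔
      ConicPosition.disc M N = 0 ∧ ConicPosition.disc' M N = 0 ∧ ConicPosition.I3 M N < 0 ∧
        ConicPosition.I5 M N < 0) := by
  obtain ⟨R, k, m, g, f, c, hR, hk, hm, hf, h, h'⟩ :=
    ConicPosition.exists_normal_form hM hN hL3 hL0
  have key : ∀ i, ConicPosition.Position M N i ↔ ConicPosition.SignCondition M N i := by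
    intro i
    rw [ConicPosition.position_transfer hR hk hm h h',
      ConicPosition.signCondition_transfer hR hk hm h h' hL3.ne hN.2.2 hM.2.1.ne']
    exact ConicPosition.position_iff_signCondition hf i
  exact ⟨key 0, key 1, key 2, key 3, key 4, key 5, key 6, key 7, key 8⟩
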